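/- **Setting.** Let $d=Jp$ with integers $J\ge 1$, $p=d/J$, let $f:\mathbb{R}^d\to\mathbb{R}$ be differentiable with gradient $g=\nabla f$, and let $\mathcal X\subseteq\mathbb{R}^d$. A permutation matrix $U=[U^{(1)},\dots,U^{(J)}]$, $U^{(j)}\in\mathbb{R}^{d\times p}$, divides the coordinates into $J$ blocks of size $p$; write $g^{(j)}(x)=(U^{(j)})^{\top}g(x)\in\mathbb{R}^p$ and let $\nabla^2_{jj}f$ be the $j$-th block Hessian. Assume: 1. $f$ is continuously differentiable and, for every choice of $U$, there are constants $L_j$ with $\|g^{(j)}(y)-g^{(j)}(y+U^{(j)}t)\|_2\le L_j\|t\|_2$ for all $j$, $y\in\mathcal X$, $t\in\mathbb{R}^p$; 2. for an integer $0<s_{\mathrm{exact}}<d$, every $g(y)$, $y\in\mathbb{R}^d$, has at most $s_{\mathrm{exact}}$ non-zero entries; 3. $f$ is twice differentiable at the points of $\mathcal X$ and, for a constant $H>0$, $\|\nabla^2_{jj}f(y)\|_1\le H$ (sum of the absolute values of the entries) for every choice of $U$, every $j$ and every $y\in\mathcal X$; 4. $f$ is accessible only through oracle answers $E_f(y)=f(y)+\xi$,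 where the noise $\xi$ may differ from call to call, may depend on everything, and satisfies $|\xi|\le\sigma$ almost surely, for a constant $\sigma>0$. **Estimator.** Given $x\in\mathbb{R}^d$, a block $j$, an integer sparsity level $s$, a number $n\ge 0$ of iterations and a constant $b_1$, put $\delta=2\sqrt{\sigma/H}$ and $m=\lceil b_1 s\log(d/J)\rceil$, and take $z_1,\dots,z_m\in\mathbb{R}^{p}$ with independent entries equal to $\pm1$ with equal probability. Query the oracle to form $y_i=\frac{E_f(x+\delta U^{(j)}z_i)-E_f(x)}{\sqrt m\,\delta}$, and let $Z$ be the $m\times p$ matrix with rows $z_i^{\top}/\sqrt m$. The estimate $\hat g^{(j)}\in\mathbb{R}^p$ is the result $a_n$ of $n$ iterations of CoSaMP: $a_0=0$, and $a_{k+1}$ is obtained from $a_k$ by letting $T$ be the union of the support of $a_k$ and the support of a best $2s$-term approximation of $Z^{\top}(y-Za_k)$, letting $b$ minimize $\|y-Zb\|_2$ over the vectors supported in $T$, and letting $a_{k+1}$ be a best $s$-term approximation of $b$ (ties broken arbitrarily). **Claim.** There are universal constants $b_0>0$, $\rho\in(0,1)$, $\tau>0$ and $C>0$ such that the following holds for every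 $b_1\ge b_0$ and all $J,p,s_{\mathrm{exact}}$ with $J\ge 1$ and $0<s_{\mathrm{exact}}<d=Jp$. (a) Let $f,\mathcal X,H,\sigma$ be as above, $n\ge 0$, let $s=s_{\mathrm{block}}$ be an integer with $s\ge 1.1\,s_{\mathrm{exact}}/J$, and fix $x\in\mathbb{R}^d$ such that all segments from $x$ to possible query points $x+\delta U^{(j)}z$, $z\in\{\pm1\}^p$, lie in $\mathcal X$ (no restriction if $\mathcal X=\mathbb{R}^d$). Choose $U$ uniformly at random, and for each block choose Rademacher sample directions as above (all blocks may share the same directions). Then with probability at least $$1-C\,J\exp\!\left(\frac{-0.01\,s_{\mathrm{exact}}}{3J}\right)$$ one has, simultaneously for all $j=1,\dots,J$, $$\|\hat g^{(j)}-g^{(j)}(x)\|_2\le\rho^{n}\,\|g^{(j)}(x)\|_2+2\tau\sqrt{\sigma H}.$$ (b) The estimator makes $Q(s)=2\lceil b_1 s\log(d/J)\rceil$ oracle calls, and for every integer $s\ge s_{\mathrm{exact}}$ (a sparsity level for blocks that are not randomized) the block sparsity level $\lceil 1.1\,s/J\rceil$ needs about $J$ times fewer: $$Q\big(\lceil 1.1\,s/J\rceil\big)\le\frac{1.1}{J}\,Q(s)+2\big(b_1\log(d/J)+1\big).$$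 -/

import Mathlib

open MeasureTheory ProbabilityTheory

noncomputable section

namespace ZOBCD

/-- `ℝⁿ` with the Euclidean norm. -/
abbrev Vec (n : ℕ) : Type := EuclideanSpace ℝ (Fin n)

/-! ### Blocks

The dimension is `d = J * p`: there are `J` blocks of equal size `p = d / J`. A permutation `π` of
the coordinates encodes the permutation matrix `U = [U⁽¹⁾, …, U⁽ᴶ⁾]` whose column number `c` is the
standard basis vector `e_{π c}`; the matrix `U⁽ʲ⁾` consists of `p` consecutive columns of `U`. -/

variable {J p : ℕ}

/-- The coordinate of `ℝᵈ` that is the `l`-th coordinate of the `j`-th block. -/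
def blockIndex (π : Equiv.Perm (Fin (J * p))) (j : Fin J) (l : Fin p) : Fin (J * p) :=
  π (finProdFinEquiv (j, l))

/-- `U⁽ʲ⁾ t`, for `t ∈ ℝᵖ`. -/
def blockEmbed (π : Equiv.Perm (Fin (J * p))) (j : Fin J) (t : Vec p) : Vec (J * p) :=
  ∑ l, t l • EuclideanSpace.single (blockIndex π j l) (1 : ℝ)

/-- The block gradient `g⁽ʲ⁾(x)`, as a vector of `ℝᵖ`. -/
def blockGrad (f : Vec (J * p) → ℝ) (π : Equiv.Perm (Fin (J * p))) (j : Fin J)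
    (x : Vec (J * p)) : Vec p :=
  WithLp.toLp 2 fun l => gradient f x (blockIndex π j l)

/-- The entry `∂_b ∂_a f (x)` of the Hessian. -/
def hessianEntry {n : ℕ} (f : Vec n → ℝ) (x : Vec n) (a b : Fin n) : ℝ :=
  fderiv ℝ (gradient f) x (EuclideanSpace.single b 1) a

/-- The element-wise `ℓ¹`-norm of the block Hessian `∇²_{jj} f (x)`. -/
def blockHessianL1 (f : Vec (J * p) → ℝ) (π : Equiv.Perm (Fin (J * p))) (j : Fin J)
    (x : Vec (J * p)) : ℝ :=
  ∑ k, ∑ l, |hessianEntry f x (blockIndex π j k) (blockIndex π j l)|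

/-! ### Assumptions on the objective

The blocks are chosen at random, so the assumptions that mention blocks are imposed for each
possible choice `π` of the blocks. -/

/-- Block Lipschitz differentiability on `X`; the Lipschitz constants may depend on the blocks. -/
def BlockLipschitz (f : Vec (J * p) → ℝ) (X : Set (Vec (J * p))) : Prop :=
  ContDiff ℝ 1 f ∧
  ∀ π : Equiv.Perm (Fin (J * p)), ∃ L : Fin J → ℝ, ∀ j, ∀ x ∈ X, ∀ t : Vec p,
    ‖blockGrad f π j x - blockGrad f π j (x + blockEmbed π j t)‖ ≤ L j * ‖t‖

/-- Sparse gradients: `‖g(x)‖₀ ≤ s` for all `x`. -/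
def SparseGradients {n : ℕ} (f : Vec n → ℝ) (s : ℕ) : Prop :=
  ∀ x, (Finset.univ.filter fun i => gradient f x i ≠ 0).card ≤ s

/-- Weakly sparse block Hessians on `X`. -/
def WeaklySparseHessian (f : Vec (J * p) → ℝ) (X : Set (Vec (J * p))) (H : ℝ) : Prop :=
  (∀ x ∈ X, DifferentiableAt ℝ (gradient f) x) ∧
  ∀ (π : Equiv.Perm (Fin (J * p))) (j : Fin J), ∀ x ∈ X, blockHessianL1 f π j x ≤ H

/-! ### CoSaMP -/

/-- The support of a vector. -/
def supp {n : ℕ} (v : Vec n) : Finset (Fin n) := Finset.univ.filter fun i => v i ≠ 0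

/-- `w` is a best `k`-term approximation of `u`: it agrees with `u` on a set of `min k n` indices
carrying the entries of largest magnitude (ties broken arbitrarily) and vanishes elsewhere. -/
def IsBestApprox {n : ℕ} (k : ℕ) (u w : Vec n) : Prop :=
  ∃ S : Finset (Fin n), S.card = min k n ∧ (∀ a ∈ S, ∀ b ∉ S, |u b| ≤ |u a|) ∧
    ∀ i, w i = if i ∈ S then u i else 0

/-- `b` is a least squares solution of `Z b ≈ y` among the vectors supported on `T`. If the columns
of `Z` in `T` are linearly independent, this says `b|_T = Z_T^† y` and `b = 0` off `T`. -/
def IsLeastSquares {m n : ℕ} (Z : Matrix (Fin m) (Fin n) ℝ) (y : Vec m) (T : Finset (Fin n))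
    (b : Vec n) : Prop :=
  supp b ⊆ T ∧ ∀ c : Vec n, supp c ⊆ T →
    ‖y - Matrix.toEuclideanLin Z b‖ ≤ ‖y - Matrix.toEuclideanLin Z c‖

/-- One iteration of CoSaMP at sparsity level `s`, from `a` to `a'`: form the proxy
`u = Zᵀ (y - Z a)`, merge the support of a best `2s`-term approximation of `u` with the support of
`a`, solve the least squares problem on the merged support, and prune to `s` terms. -/
def CoSaMPStep {m n : ℕ} (Z : Matrix (Fin m) (Fin n) ℝ) (y : Vec m) (s : ℕ) (a a' : Vec n) :
    Prop :=
  ∃ w b : Vec n,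
    IsBestApprox (2 * s) (Matrix.toEuclideanLin Z.transpose (y - Matrix.toEuclideanLin Z a)) w ∧
    IsLeastSquares Z y (supp w ∪ supp a) b ∧
    IsBestApprox s b a'

/-- `v` is the result of `N` iterations of CoSaMP at sparsity level `s`, started at `0`. -/
def IsCoSaMPOutput {m n : ℕ} (Z : Matrix (Fin m) (Fin n) ℝ) (y : Vec m) (s N : ℕ) (v : Vec n) :
    Prop :=
  ∃ a : ℕ → Vec n, a 0 = 0 ∧ (∀ k < N, CoSaMPStep Z y s (a k) (a (k + 1))) ∧ a N = v

/-! ### Block gradient estimation -/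

/-- The number `m = b₁ s log(d/J)` of sample directions, rounded up. -/
def numDirections (b₁ : ℝ) (s p : ℕ) : ℕ := ⌈b₁ * s * Real.log p⌉₊

/-- The labels of the oracle calls of the gradient estimator with `m` directions: `(i, true)` is
the call at the point `x + δ U⁽ʲ⁾ zᵢ` and `(i, false)` is the call at `x` in the same pass. -/
abbrev QueryLabel (m : ℕ) : Type := Fin m × Bool

/-- The number of oracle calls of the gradient estimator with `m` directions. -/
def numQueries (m : ℕ) : ℕ := Fintype.card (QueryLabel m)

/-- The point at which each oracle call is made. -/
def queryPoint {m : ℕ} (π : Equiv.Perm (Fin (J * p))) (j : Fin J) (x : Vec (J * p)) (δ : ℝ)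
    (z : Matrix (Fin m) (Fin p) ℝ) : QueryLabel m → Vec (J * p)
  | (i, true) => x + δ • blockEmbed π j (WithLp.toLp 2 (z i))
  | (_, false) => x

/-- The finite differences `yᵢ = (E_f(x + δ U⁽ʲ⁾ zᵢ) - E_f(x)) / (√m δ)`, where the answer of the
noisy oracle to the call labelled `q` is the value of `f` at the query point plus `ξ q`. -/
def measurements {m : ℕ} (f : Vec (J * p) → ℝ) (π : Equiv.Perm (Fin (J * p))) (j : Fin J)
    (x : Vec (J * p)) (δ : ℝ) (z : Matrix (Fin m) (Fin p) ℝ) (ξ : QueryLabel m → ℝ) : Vec m :=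
  WithLp.toLp 2 fun i =>
    ((f (queryPoint π j x δ z (i, true)) + ξ (i, true)) -
      (f (queryPoint π j x δ z (i, false)) + ξ (i, false))) / (Real.sqrt m * δ)

/-- `v` is an output of the block gradient estimator for block `j` at `x`, with sparsity level `s`,
query radius `δ`, `N` iterations of CoSaMP, sample directions the rows of `z`, and noise `ξ`. -/
def IsGradientEstimate {m : ℕ} (f : Vec (J * p) → ℝ) (π : Equiv.Perm (Fin (J * p))) (j : Fin J)
    (x : Vec (J * p)) (s : ℕ) (δ : ℝ) (N : ℕ) (z : Matrix (Fin m) (Fin p) ℝ)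
    (ξ : QueryLabel m → ℝ) (v : Vec p) : Prop :=
  IsCoSaMPOutput ((1 / Real.sqrt m) • z) (measurements f π j x δ z ξ) s N v

/-! ### Randomness -/

variable {Ω : Type*} [MeasurableSpace Ω]

/-- The random permutation `U` is uniformly distributed. -/
def IsUniformPerm {n : ℕ} (U : Ω → Equiv.Perm (Fin n)) (μ : Measure Ω) : Prop :=
  ∀ π, MeasurableSet (U ⁻¹' {π}) ∧ μ (U ⁻¹' {π}) = (n.factorial : ENNReal)⁻¹

/-- The entries of the random matrix `z` are independent and equal to `1` or `-1` with equal
probability. -/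
structure IsRademacher {m n : ℕ} (z : Ω → Matrix (Fin m) (Fin n) ℝ) (μ : Measure Ω) : Prop where
  measurable : ∀ i l, Measurable fun ω => z ω i l
  prob_one : ∀ i l, μ {ω | z ω i l = 1} = 1 / 2
  prob_neg_one : ∀ i l, μ {ω | z ω i l = -1} = 1 / 2
  indep : iIndepFun (fun (q : Fin m × Fin n) ω => z ω q.1 q.2) μ

end ZOBCD

end

open ZOBCD

/-!
The proof combines three facts about one block `j`.

*Few non-zeros per block.* The number of non-zeros of the gradient that a uniformly random
permutation sends to a given block is hypergeometric. Its moment generating function is at most that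
of the binomial variable with the same mean (`sum_perm_one_add_pow_le`), so Chernoff's bound gives
more than `1.1 sExact / J` non-zeros with probability at most `exp (-0.01 sExact / (3 J))`
(`card_perm_overfull_le`).

*Restricted isometry.* For a unit vector `x` and a uniform sign vector `z` the variable `⟨x, z⟩²` has
exponential moments (`sum_exp_signSum_sq_le`), hence averages of `m` independent copies concentrate
around `1` exponentially well in `m` (`card_unit_deviation_le`). A union bound over finitely many
test vectors for each support of size `4 s` shows that the sign matrix is close to an isometry on all
`4 s`-sparse vectors (`card_not_restrictedIsometry_le`), because `m` is a large multiple of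
`s log p`. Rademacher matrices are uniform on the sign matrices, so probabilities are counts there.

*Recovery.* Restricted isometry makes CoSaMP halve the error at each iteration up to a multiple of
the measurement error (`CoSaMPStep.norm_sub_le`). The finite differences measure the block gradient
with an error made of the oracle noise and of a second-order Taylor remainder, and
`δ = 2 √(σ / H)` makes both of size `√(σ H)` (`measurements_eq_add_error`).

Restricted isometry holds for all sparse vectors at once, so the union bound over the exceptional
events of all blocks (`exists_event_norm_estimate_sub_le`) needs no independence between the
permutation, the directions of different blocks and the noise.
-/

open MeasureTheory ProbabilityTheory

namespace ZOBCD

/-! ### Tails of the hypergeometric distribution -/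

section Hypergeometric

variable {α : Type*} [Fintype α] [DecidableEq α]

/-- The permutations that map `T` into `S`. -/
def permsInto (S T : Finset α) : Finset (Equiv.Perm α) :=
  Finset.univ.filter fun π => ∀ t ∈ T, π t ∈ S

/-- Prescribing that one more point be mapped into `S` thins out the permutations at least by the
density of `S`: the count of those with `π a ∈ S` is at most the count of those with `π b ∈ S`, for
every `b`, and the latter counts average to the density. -/
theorem card_permsInto_insert_le (S T : Finset α) {a : α} (ha : a ∉ T) :
    Fintype.card α * (permsInto S (insert a T)).card ≤ S.card * (permsInto S T).card := by
  have key : ∀ b : α, (permsInto S (insert a T)).card ≤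
      ((permsInto S T).filter fun π => π b ∈ S).card := by
    intro b
    by_cases hb : b ∈ T
    · apply Finset.card_le_card
      intro π hπ
      simp only [permsInto, Finset.mem_filter, Finset.mem_univ, true_and] at hπ ⊢
      exact ⟨fun t ht => hπ t (Finset.mem_insert_of_mem ht),
        hπ b (Finset.mem_insert_of_mem hb)⟩
    · -- for `b ∉ T`, exchanging `a` and `b` does not affect the condition on `T`
      refine Finset.card_le_card_of_injOn (fun π => π * Equiv.swap a b) ?_ ?_
      · intro π hπ
        simp only [permsInto, Finset.coe_filter, Finset.mem_filter, Finset.mem_univ, true_and,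
          Set.mem_ofPred_eq] at hπ ⊢
        refine ⟨fun t ht => ?_, ?_⟩
        · have h1 : t ≠ a := fun h => ha (h ▸ ht)
          have h2 : t ≠ b := fun h => hb (h ▸ ht)
          simpa [Equiv.swap_apply_of_ne_of_ne h1 h2] using hπ t (Finset.mem_insert_of_mem ht)
        · simpa using hπ a (Finset.mem_insert_self _ _)
      · intro π _ π' _ h
        exact mul_right_cancel h
  have count : ∑ b : α, ((permsInto S T).filter fun π => π b ∈ S).card =
      S.card * (permsInto S T).card := by
    simp only [Finset.card_filter]
    rw [Finset.sum_comm]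
    have : ∀ π : Equiv.Perm α, ∑ b : α, (if π b ∈ S then 1 else 0) = S.card := by
      intro π
      rw [Equiv.sum_comp π (fun c => if c ∈ S then 1 else 0)]
      simp
    simp [this, mul_comm]
  calc Fintype.card α * (permsInto S (insert a T)).card
      = ∑ _b : α, (permsInto S (insert a T)).card := by simp
    _ ≤ _ := Finset.sum_le_sum fun b _ => key b
    _ = _ := count

theorem card_permsInto_le (S T : Finset α) :
    Fintype.card α ^ T.card * (permsInto S T).card ≤
      S.card ^ T.card * (Fintype.card α).factorial := by
  induction T using Finset.induction_on with
  | empty => simp [permsInto, Fintype.card_perm]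
  | insert a T ha ih =>
    rw [Finset.card_insert_of_notMem ha, pow_succ, pow_succ]
    calc Fintype.card α ^ T.card * Fintype.card α * (permsInto S (insert a T)).card
        = Fintype.card α ^ T.card * (Fintype.card α * (permsInto S (insert a T)).card) := by ring
      _ ≤ Fintype.card α ^ T.card * (S.card * (permsInto S T).card) :=
        Nat.mul_le_mul_left _ (card_permsInto_insert_le S T ha)
      _ = S.card * (Fintype.card α ^ T.card * (permsInto S T).card) := by ring
      _ ≤ S.card * (S.card ^ T.card * (Fintype.card α).factorial) := Nat.mul_le_mul_left _ ih
      _ = _ := by ring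

/-- The moment generating function of a hypergeometric variable is at most that of the binomial
variable with the same mean: expand `(1 + lam) ^ X` over the subsets of `B`. -/
theorem sum_perm_one_add_pow_le [Nonempty α] (S B : Finset α) {lam : ℝ} (hl : 0 ≤ lam) :
    ∑ π : Equiv.Perm α, (1 + lam) ^ (B.filter fun b => π b ∈ S).card ≤
      (Fintype.card α).factorial *
        (1 + lam * S.card / Fintype.card α) ^ B.card := by
  have hd : (0 : ℝ) < Fintype.card α := by exact_mod_cast Fintype.card_pos
  have e1 : ∀ π : Equiv.Perm α, (1 + lam) ^ (B.filter fun b => π b ∈ S).card =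
      ∑ T ∈ B.powerset, if π ∈ permsInto S T then lam ^ T.card else 0 := by
    intro π
    have : (1 + lam) ^ (B.filter fun b => π b ∈ S).card =
        ∏ b ∈ B, (1 + if π b ∈ S then lam else 0) := by
      rw [← Finset.prod_const, Finset.prod_filter]
      exact Finset.prod_congr rfl fun b _ => by split_ifs <;> simp
    rw [this, Finset.prod_one_add]
    refine Finset.sum_congr rfl fun T _ => ?_
    by_cases h : π ∈ permsInto S T
    · rw [if_pos h]
      simp only [permsInto, Finset.mem_filter, Finset.mem_univ, true_and] at h
      rw [Finset.prod_congr rfl fun t ht => if_pos (h t ht), Finset.prod_const]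
    · rw [if_neg h]
      simp only [permsInto, Finset.mem_filter, Finset.mem_univ, true_and, not_forall] at h
      obtain ⟨t, ht, h⟩ := h
      exact Finset.prod_eq_zero ht (if_neg h)
  have e2 : ∀ T : Finset α, ∑ π : Equiv.Perm α, (if π ∈ permsInto S T then lam ^ T.card else 0) ≤
      (Fintype.card α).factorial * ∏ _t ∈ T, (lam * S.card / Fintype.card α) := by
    intro T
    rw [← Finset.sum_filter, Finset.sum_const, nsmul_eq_mul, Finset.prod_const, div_pow, mul_pow]
    have h := card_permsInto_le S T
    have h' : (Fintype.card α : ℝ) ^ T.card * (permsInto S T).card ≤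
      (S.card : ℝ) ^ T.card * (Fintype.card α).factorial := by exact_mod_cast h
    have hf : (Finset.univ.filter fun π => π ∈ permsInto S T) = permsInto S T := by ext; simp
    rw [hf, mul_div_assoc', le_div_iff₀ (by positivity)]
    calc _ = lam ^ T.card * ((Fintype.card α : ℝ) ^ T.card * (permsInto S T).card) := by ring
      _ ≤ lam ^ T.card * ((S.card : ℝ) ^ T.card * (Fintype.card α).factorial) := by gcongr
      _ = _ := by ring
  calc _ = ∑ T ∈ B.powerset, ∑ π : Equiv.Perm α,
        (if π ∈ permsInto S T then lam ^ T.card else 0) := by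
        rw [Finset.sum_comm]; exact Finset.sum_congr rfl fun π _ => e1 π
    _ ≤ ∑ T ∈ B.powerset,
        (Fintype.card α).factorial * ∏ _t ∈ T, (lam * S.card / Fintype.card α) :=
        Finset.sum_le_sum fun T _ => e2 T
    _ = _ := by rw [← Finset.mul_sum, ← Finset.prod_one_add, Finset.prod_const]

/-- Chernoff's bound for the hypergeometric distribution, for a deviation by ten percent from (an
upper bound `M` of) the mean. -/
theorem card_perm_overfull_le [Nonempty α] (S B : Finset α) {M : ℝ}
    (hM : (B.card * S.card : ℝ) / Fintype.card α ≤ M) :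
    ((Finset.univ.filter fun π : Equiv.Perm α =>
      1.1 * M < ((B.filter fun b => π b ∈ S).card : ℝ)).card : ℝ) ≤
      (Fintype.card α).factorial * Real.exp (-(0.01 * M) / 3) := by
  have hd : (0 : ℝ) < Fintype.card α := by exact_mod_cast Fintype.card_pos
  have hM0 : 0 ≤ M := le_trans (by positivity) hM
  have hlog : (2 * 0.1 / (0.1 + 2) : ℝ) ≤ Real.log (1 + 0.1) :=
    Real.le_log_one_add_of_nonneg (by norm_num)
  -- Markov's inequality for `(1 + 0.1) ^ X`; it suffices that `1.1 log 1.1 - 0.1 ≥ 0.01 / 3`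
  set F := Finset.univ.filter fun π : Equiv.Perm α =>
      1.1 * M < ((B.filter fun b => π b ∈ S).card : ℝ) with hF
  have lower : (F.card : ℝ) * Real.exp (1.1 * M * Real.log (1 + 0.1)) ≤
      ∑ π : Equiv.Perm α, (1 + 0.1 : ℝ) ^ (B.filter fun b => π b ∈ S).card := by
    rw [← nsmul_eq_mul, ← Finset.sum_const]
    refine (Finset.sum_le_sum fun π hπ => ?_).trans
      (Finset.sum_le_sum_of_subset_of_nonneg (Finset.subset_univ F) fun _ _ _ => by positivity)
    rw [← Real.exp_log (show (0 : ℝ) < (1 + 0.1) ^ (B.filter fun b => π b ∈ S).card by positivity),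
      Real.log_pow]
    have := (Finset.mem_filter.1 hπ).2
    gcongr
  have upper := sum_perm_one_add_pow_le S B (show (0 : ℝ) ≤ 0.1 by norm_num)
  have upper' : (1 + 0.1 * S.card / Fintype.card α : ℝ) ^ B.card ≤ Real.exp (0.1 * M) := by
    calc (1 + 0.1 * S.card / Fintype.card α : ℝ) ^ B.card
        ≤ Real.exp (0.1 * S.card / Fintype.card α) ^ B.card := by
          gcongr; rw [add_comm]; exact Real.add_one_le_exp _
      _ = Real.exp (0.1 * ((B.card * S.card : ℝ) / Fintype.card α)) := by
          rw [← Real.exp_nat_mul]; congr 1; ring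
      _ ≤ _ := by gcongr
  have h1 : (F.card : ℝ) * Real.exp (1.1 * M * Real.log (1 + 0.1)) ≤
      (Fintype.card α).factorial * Real.exp (0.1 * M) :=
    lower.trans (upper.trans (by gcongr))
  have h2 : Real.exp (0.1 * M) ≤
      Real.exp (-(0.01 * M) / 3) * Real.exp (1.1 * M * Real.log (1 + 0.1)) := by
    rw [← Real.exp_add]
    apply Real.exp_le_exp.2
    nlinarith [mul_le_mul_of_nonneg_left hlog hM0]
  refine le_of_mul_le_mul_right (h1.trans ?_) (Real.exp_pos (1.1 * M * Real.log (1 + 0.1)))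
  calc _ ≤ ((Fintype.card α).factorial : ℝ) * (Real.exp (-(0.01 * M) / 3) *
        Real.exp (1.1 * M * Real.log (1 + 0.1))) := by gcongr
    _ = _ := by ring

end Hypergeometric

/-! ### Concentration for random sign vectors -/

section Signs

/-- The sign encoded by a Boolean. -/
def boolSign (b : Bool) : ℝ := if b then 1 else -1

@[simp] theorem boolSign_true : boolSign true = 1 := rfl
@[simp] theorem boolSign_false : boolSign false = -1 := rfl

theorem boolSign_mul_self (b : Bool) : boolSign b * boolSign b = 1 := by cases b <;> norm_num

theorem boolSign_not (b : Bool) : boolSign (!b) = -boolSign b := by cases b <;> norm_num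

variable {ι : Type*} [Fintype ι]

/-- The linear form `⟨x, ·⟩` at the sign vector encoded by `r`. -/
def signSum (x : ι → ℝ) (r : ι → Bool) : ℝ := ∑ l, x l * boolSign (r l)

variable [DecidableEq ι]

/-- A linear form at a random sign vector is sub-Gaussian, by `cosh t ≤ exp (t² / 2)`. -/
theorem sum_exp_signSum_le (x : ι → ℝ) (t : ℝ) :
    ∑ r, Real.exp (t * signSum x r) ≤
      2 ^ Fintype.card ι * Real.exp (t ^ 2 * (∑ l, x l ^ 2) / 2) := by
  have h1 : ∑ r, Real.exp (t * signSum x r) =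
      ∏ l, ∑ b : Bool, Real.exp (t * (x l * boolSign b)) := by
    rw [Finset.prod_univ_sum, Fintype.piFinset_univ]
    refine Finset.sum_congr rfl fun r _ => ?_
    rw [signSum, Finset.mul_sum, Real.exp_sum]
  rw [h1]
  have h2 : ∀ l, ∑ b : Bool, Real.exp (t * (x l * boolSign b)) ≤
      2 * Real.exp ((t * x l) ^ 2 / 2) := by
    intro l
    have := Real.cosh_le_exp_half_sq (t * x l)
    rw [Real.cosh_eq] at this
    simp only [Fintype.sum_bool, boolSign_true, boolSign_false, mul_one, mul_neg]
    linarith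
  refine (Finset.prod_le_prod (fun l _ => Finset.sum_nonneg fun b _ => (Real.exp_pos _).le)
    fun l _ => h2 l).trans (le_of_eq ?_)
  rw [Finset.prod_mul_distrib, Finset.prod_const, ← Real.exp_sum, Finset.card_univ]
  congr 2
  rw [Finset.mul_sum, Finset.sum_div]
  exact Finset.sum_congr rfl fun l _ => by ring

theorem sum_boolSign_mul (k l : ι) :
    ∑ r : ι → Bool, boolSign (r k) * boolSign (r l) =
      if k = l then 2 ^ Fintype.card ι else 0 := by
  split_ifs with h
  · subst h
    simp [boolSign_mul_self]
  · -- flipping the sign at `k` flips the sign of the summand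
    refine Finset.sum_involution (fun r _ => Function.update r k (!r k)) ?_ ?_ ?_ ?_
    · intro r _
      simp [Function.update_of_ne (Ne.symm h), boolSign_not]
    · intro r _ _ h'
      have := congrFun h' k
      simp at this
    · simp
    · intro r _
      simp

theorem sum_signSum_sq (x : ι → ℝ) :
    ∑ r, signSum x r ^ 2 = 2 ^ Fintype.card ι * ∑ l, x l ^ 2 := by
  have h : ∀ r, signSum x r ^ 2 =
      ∑ k, ∑ l, x k * x l * (boolSign (r k) * boolSign (r l)) := by
    intro r
    rw [signSum, sq, Finset.sum_mul_sum]
    exact Finset.sum_congr rfl fun k _ => Finset.sum_congr rfl fun l _ => by ring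
  simp_rw [h]
  rw [Finset.sum_comm, Finset.mul_sum]
  refine Finset.sum_congr rfl fun k _ => ?_
  rw [Finset.sum_comm]
  simp_rw [← Finset.mul_sum, sum_boolSign_mul]
  simp
  ring

/-- Linearize the square by a Gaussian integral: `exp (lam X²)` is the average of
`exp (2 √lam t X)` against the density proportional to `exp (-t²)`. -/
theorem sum_exp_signSum_sq_le (x : ι → ℝ) (hx : ∑ l, x l ^ 2 = 1) {lam : ℝ} (h0 : 0 ≤ lam)
    (h1 : lam < 1 / 2) :
    ∑ r, Real.exp (lam * signSum x r ^ 2) ≤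
      2 ^ Fintype.card ι * Real.sqrt (1 / (1 - 2 * lam)) := by
  have shift : ∀ a : ℝ, ∫ t : ℝ, Real.exp (-t ^ 2 + 2 * a * t) =
      Real.exp (a ^ 2) * Real.sqrt Real.pi := by
    intro a
    have := integral_sub_right_eq_self (μ := volume)
      (fun t : ℝ => Real.exp (a ^ 2) * Real.exp (-1 * t ^ 2)) a
    rw [integral_const_mul, integral_const_mul, integral_gaussian, div_one] at this
    rw [← this, ← integral_const_mul]
    congr 1
    funext t
    rw [← Real.exp_add]
    congr 1
    ring
  have hint : ∀ a : ℝ, Integrable fun t : ℝ => Real.exp (-t ^ 2 + 2 * a * t) := by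
    intro a
    have := ((integrable_exp_neg_mul_sq (b := 1) one_pos).const_mul (Real.exp (a ^ 2))).comp_sub_right a
    refine this.congr (Filter.Eventually.of_forall fun t => ?_)
    simp only
    rw [← Real.exp_add]
    congr 1
    ring
  have hs : Real.sqrt lam ^ 2 = lam := Real.sq_sqrt h0
  have hpi : 0 < Real.sqrt Real.pi := Real.sqrt_pos.2 Real.pi_pos
  refine le_of_mul_le_mul_right ?_ hpi
  have hb : 0 < 1 - 2 * lam := by linarith
  calc (∑ r, Real.exp (lam * signSum x r ^ 2)) * Real.sqrt Real.pi
      = ∑ r, ∫ t : ℝ, Real.exp (-t ^ 2 + 2 * (Real.sqrt lam * signSum x r) * t) := by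
        rw [Finset.sum_mul]
        refine Finset.sum_congr rfl fun r _ => ?_
        rw [shift, mul_pow, hs]
    _ = ∫ t : ℝ, ∑ r, Real.exp (-t ^ 2 + 2 * (Real.sqrt lam * signSum x r) * t) :=
        (integral_finsetSum _ fun r _ => hint _).symm
    _ ≤ ∫ t : ℝ, 2 ^ Fintype.card ι * Real.exp (-(1 - 2 * lam) * t ^ 2) := by
        refine integral_mono (integrable_finsetSum _ fun r _ => hint _)
          ((integrable_exp_neg_mul_sq hb).const_mul _) fun t => ?_
        have := sum_exp_signSum_le x (2 * Real.sqrt lam * t)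
        rw [hx] at this
        calc ∑ r, Real.exp (-t ^ 2 + 2 * (Real.sqrt lam * signSum x r) * t)
            = Real.exp (-t ^ 2) * ∑ r, Real.exp (2 * Real.sqrt lam * t * signSum x r) := by
              rw [Finset.mul_sum]
              refine Finset.sum_congr rfl fun r _ => ?_
              rw [← Real.exp_add]
              congr 1
              ring
          _ ≤ Real.exp (-t ^ 2) * (2 ^ Fintype.card ι *
                Real.exp ((2 * Real.sqrt lam * t) ^ 2 * 1 / 2)) := by gcongr
          _ = _ := by
              rw [mul_left_comm, ← Real.exp_add, mul_pow, mul_pow, hs]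
              congr 2
              ring
    _ = _ := by
        rw [integral_const_mul, integral_gaussian, mul_assoc, ← Real.sqrt_mul (by positivity)]
        congr 2
        ring

/-- Exponential moment for the upper tail of `X²`, where `X` is a linear form of unit norm at a random
sign vector. The deviation is `1/40`; the parameter `1/160` nearly minimizes the exponent. -/
theorem sum_exp_upper_le (x : ι → ℝ) (hx : ∑ l, x l ^ 2 = 1) :
    ∑ r, Real.exp (1 / 160 * (signSum x r ^ 2 - (1 + 1 / 40))) ≤
      2 ^ Fintype.card ι * Real.exp (-1 / 25000) := by
  have h := sum_exp_signSum_sq_le x hx (lam := 1 / 160) (by norm_num) (by norm_num)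
  -- `1 / (1 - t) = 1 + t / (1 - t) ≤ exp (t / (1 - t))` at `t = 1/80`
  have h2 : Real.sqrt (1 / (1 - 2 * (1 / 160))) ≤ Real.exp (1 / 158) := by
    rw [Real.sqrt_le_left (Real.exp_pos _).le, ← Real.exp_nat_mul]
    have := Real.add_one_le_exp (((2 : ℕ) : ℝ) * (1 / 158))
    norm_num at this ⊢
    linarith
  calc _ = (∑ r, Real.exp (1 / 160 * signSum x r ^ 2)) * Real.exp (-(1 / 160 * (1 + 1 / 40))) := by
        rw [Finset.sum_mul]
        refine Finset.sum_congr rfl fun r _ => ?_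
        rw [← Real.exp_add]
        congr 1
        ring
    _ ≤ (2 ^ Fintype.card ι * Real.exp (1 / 158)) * Real.exp (-(1 / 160 * (1 + 1 / 40))) := by
        gcongr
        exact h.trans (by gcongr)
    _ ≤ _ := by
        rw [mul_assoc, ← Real.exp_add]
        gcongr
        norm_num

theorem exp_neg_le_quadratic {y : ℝ} (hy : 0 ≤ y) : Real.exp (-y) ≤ 1 - y + y ^ 2 / 2 := by
  have h := Real.quadratic_le_exp_of_nonneg hy
  rw [Real.exp_neg]
  refine (inv_anti₀ (by positivity) h).trans ?_
  rw [inv_le_iff_one_le_mul₀ (by positivity)]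
  nlinarith [sq_nonneg (y ^ 2)]

/-- The exponential moment of `X²` at `1/4` controls the fourth moment, by `1 + y + y²/2 ≤ exp y`. -/
theorem sum_signSum_pow_four_le (x : ι → ℝ) (hx : ∑ l, x l ^ 2 = 1) :
    ∑ r, signSum x r ^ 4 ≤ 2 ^ Fintype.card ι * 6 := by
  have h := sum_exp_signSum_sq_le x hx (lam := 1 / 4) (by norm_num) (by norm_num)
  have hs : Real.sqrt (1 / (1 - 2 * (1 / 4))) ≤ 1.42 := by
    rw [Real.sqrt_le_left (by norm_num)]
    norm_num
  have hq : ∀ r, signSum x r ^ 4 ≤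
      32 * (Real.exp (1 / 4 * signSum x r ^ 2) - 1 - 1 / 4 * signSum x r ^ 2) := by
    intro r
    have := Real.quadratic_le_exp_of_nonneg (show 0 ≤ 1 / 4 * signSum x r ^ 2 by positivity)
    nlinarith
  refine (Finset.sum_le_sum fun r _ => hq r).trans ?_
  rw [← Finset.mul_sum, Finset.sum_sub_distrib, Finset.sum_sub_distrib, ← Finset.mul_sum,
    sum_signSum_sq, hx]
  have hc : ∑ _r : ι → Bool, (1 : ℝ) = 2 ^ Fintype.card ι := by simp
  rw [hc]
  have : (2 : ℝ) ^ Fintype.card ι * Real.sqrt (1 / (1 - 2 * (1 / 4))) ≤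
    2 ^ Fintype.card ι * 1.42 := by gcongr
  have hp : (0 : ℝ) < 2 ^ Fintype.card ι := by positivity
  linarith

/-- Exponential moment for the lower tail of `X²`, from the second and fourth moments of `X`. -/
theorem sum_exp_lower_le (x : ι → ℝ) (hx : ∑ l, x l ^ 2 = 1) :
    ∑ r, Real.exp (1 / 320 * ((1 - 1 / 40) - signSum x r ^ 2)) ≤
      2 ^ Fintype.card ι * Real.exp (-1 / 25000) := by
  have hc : ∑ _r : ι → Bool, (1 : ℝ) = 2 ^ Fintype.card ι := by simp
  have hp : (0 : ℝ) < 2 ^ Fintype.card ι := by positivity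
  have h : ∑ r, Real.exp (-(1 / 320 * signSum x r ^ 2)) ≤
      2 ^ Fintype.card ι * Real.exp (-1 / 320 + 3 / 102400) := by
    have h4 := sum_signSum_pow_four_le x hx
    calc ∑ r, Real.exp (-(1 / 320 * signSum x r ^ 2))
        ≤ ∑ r, (1 - 1 / 320 * signSum x r ^ 2 + 1 / 204800 * signSum x r ^ 4) :=
          Finset.sum_le_sum fun r _ =>
            (exp_neg_le_quadratic (by positivity)).trans (le_of_eq (by ring))
      _ = 2 ^ Fintype.card ι * (1 - 1 / 320) + 1 / 204800 * ∑ r, signSum x r ^ 4 := by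
          rw [Finset.sum_add_distrib, Finset.sum_sub_distrib, ← Finset.mul_sum, ← Finset.mul_sum,
            sum_signSum_sq, hx, hc]
          ring
      _ ≤ 2 ^ Fintype.card ι * ((-1 / 320 + 3 / 102400) + 1) := by linarith
      _ ≤ _ := by gcongr; exact Real.add_one_le_exp _
  calc _ = (∑ r, Real.exp (-(1 / 320 * signSum x r ^ 2))) *
        Real.exp (1 / 320 * (1 - 1 / 40)) := by
        rw [Finset.sum_mul]
        refine Finset.sum_congr rfl fun r _ => ?_
        rw [← Real.exp_add]
        congr 1
        ring
    _ ≤ (2 ^ Fintype.card ι * Real.exp (-1 / 320 + 3 / 102400)) *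
        Real.exp (1 / 320 * (1 - 1 / 40)) := by gcongr
    _ ≤ _ := by
        rw [mul_assoc, ← Real.exp_add]
        gcongr
        norm_num

/-- Chernoff's bound, as a count of the tuples of `m` independent uniform samples. -/
theorem card_pos_sum_le {R : Type*} [Fintype R] {m : ℕ} (G : R → ℝ) {K : ℝ}
    (hK : ∑ r, Real.exp (G r) ≤ K) :
    ((Finset.univ.filter fun ε : Fin m → R => 0 < ∑ i, G (ε i)).card : ℝ) ≤ K ^ m := by
  calc ((Finset.univ.filter fun ε : Fin m → R => 0 < ∑ i, G (ε i)).card : ℝ)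
      = ∑ ε ∈ Finset.univ.filter fun ε : Fin m → R => 0 < ∑ i, G (ε i), (1 : ℝ) := by simp
    _ ≤ ∑ ε ∈ Finset.univ.filter fun ε : Fin m → R => 0 < ∑ i, G (ε i),
          ∏ i, Real.exp (G (ε i)) := by
        refine Finset.sum_le_sum fun ε hε => ?_
        rw [← Real.exp_sum]
        exact Real.one_le_exp (Finset.mem_filter.1 hε).2.le
    _ ≤ ∑ ε : Fin m → R, ∏ i, Real.exp (G (ε i)) :=
        Finset.sum_le_sum_of_subset_of_nonneg (Finset.subset_univ _)
          fun _ _ _ => Finset.prod_nonneg fun _ _ => (Real.exp_pos _).le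
    _ = (∑ r, Real.exp (G r)) ^ m := by
        have h := Finset.prod_univ_sum (fun _ : Fin m => (Finset.univ : Finset R))
          (fun _ r => Real.exp (G r))
        rw [Fintype.piFinset_univ] at h
        rw [← h]
        simp
    _ ≤ K ^ m := pow_le_pow_left₀ (Finset.sum_nonneg fun _ _ => (Real.exp_pos _).le) hK m

/-- Concentration of `∑ i, ⟨x, zᵢ⟩²` for a unit vector `x` and random sign vectors `zᵢ`. -/
theorem card_unit_deviation_le {m : ℕ} (x : ι → ℝ) (hx : ∑ l, x l ^ 2 = 1) :
    ((Finset.univ.filter fun ε : Fin m → ι → Bool =>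
      (m : ℝ) * (1 / 40) < |∑ i, signSum x (ε i) ^ 2 - m|).card : ℝ) ≤
      2 * (2 ^ Fintype.card ι * Real.exp (-1 / 25000)) ^ m := by
  have hu := card_pos_sum_le (m := m) _ (sum_exp_upper_le x hx)
  have hl := card_pos_sum_le (m := m) _ (sum_exp_lower_le x hx)
  have hsub : (Finset.univ.filter fun ε : Fin m → ι → Bool =>
      (m : ℝ) * (1 / 40) < |∑ i, signSum x (ε i) ^ 2 - m|) ⊆
      (Finset.univ.filter fun ε : Fin m → ι → Bool =>
        0 < ∑ i, 1 / 160 * (signSum x (ε i) ^ 2 - (1 + 1 / 40))) ∪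
      (Finset.univ.filter fun ε : Fin m → ι → Bool =>
        0 < ∑ i, 1 / 320 * ((1 - 1 / 40) - signSum x (ε i) ^ 2)) := by
    intro ε hε
    simp only [Finset.mem_filter, Finset.mem_univ, true_and, Finset.mem_union] at hε ⊢
    simp only [← Finset.mul_sum, Finset.sum_sub_distrib, Finset.sum_const, Finset.card_univ,
      Fintype.card_fin, nsmul_eq_mul]
    rcases lt_abs.1 hε with h | h
    · left; linarith
    · right; linarith
  have h := (Finset.card_le_card hsub).trans (Finset.card_union_le _ _)
  have h' := (Nat.cast_le (α := ℝ)).2 h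
  rw [Nat.cast_add] at h'
  linarith

end Signs

/-! ### Restricted isometry and nets -/

section Nets

/-- A `1/2`-net of the unit ball with at most `5 ^ dim` points, namely half a maximal `1`-separated
subset of the ball of radius `2`. -/
theorem exists_half_net (E : Type*) [NormedAddCommGroup E] [NormedSpace ℝ E]
    [FiniteDimensional ℝ E] :
    ∃ N : Finset E, N.card ≤ 5 ^ Module.finrank ℝ E ∧ (∀ n ∈ N, ‖n‖ ≤ 1) ∧
      ∀ x : E, ‖x‖ ≤ 1 → ∃ n ∈ N, ‖x - n‖ ≤ 1 / 2 := by
  classical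
  let P : ℕ → Prop := fun k => ∃ s : Finset E, s.card = k ∧ (∀ c ∈ s, ‖c‖ ≤ 2) ∧
    ∀ c ∈ s, ∀ d ∈ s, c ≠ d → 1 ≤ ‖c - d‖
  have hbound : ∀ k, P k → k ≤ 5 ^ Module.finrank ℝ E := by
    rintro k ⟨s, rfl, h1, h2⟩
    exact Besicovitch.card_le_of_separated s h1 h2
  have h0 : P 0 := ⟨∅, by simp⟩
  obtain ⟨s, hcard, hs2, hsep⟩ : P (Nat.findGreatest P (5 ^ Module.finrank ℝ E)) :=
    Nat.findGreatest_spec (Nat.zero_le _) h0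
  have hmax : ∀ x : E, ‖x‖ ≤ 2 → ∃ c ∈ s, ‖x - c‖ ≤ 1 := by
    intro x hx
    by_contra! hcon
    have hxs : x ∉ s := fun hxs => by
      have := hcon x hxs
      simp at this
      linarith
    have hP : P (s.card + 1) := by
      refine ⟨insert x s, Finset.card_insert_of_notMem hxs, ?_, ?_⟩
      · intro c hc
        rcases Finset.mem_insert.1 hc with rfl | hc
        · exact hx
        · exact hs2 c hc
      · intro c hc d hd hcd
        rcases Finset.mem_insert.1 hc with rfl | hc' <;> rcases Finset.mem_insert.1 hd with rfl | hd'
        · exact absurd rfl hcd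
        · exact (hcon d hd').le
        · rw [norm_sub_rev]; exact (hcon c hc').le
        · exact hsep c hc' d hd' hcd
    have := Nat.le_findGreatest (hbound _ hP) hP
    omega
  refine ⟨s.image fun c => (1 / 2 : ℝ) • c,
    Finset.card_image_le.trans (Besicovitch.card_le_of_separated s hs2 hsep), ?_, ?_⟩
  · intro n hn
    obtain ⟨c, hc, rfl⟩ := Finset.mem_image.1 hn
    have := hs2 c hc
    rw [norm_smul, Real.norm_of_nonneg (by norm_num)]
    linarith
  · intro x hx
    obtain ⟨c, hc, h⟩ := hmax ((2 : ℝ) • x) (by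
      rw [norm_smul, Real.norm_of_nonneg (by norm_num)]; linarith)
    refine ⟨_, Finset.mem_image_of_mem _ hc, ?_⟩
    have : x - (1 / 2 : ℝ) • c = (1 / 2 : ℝ) • ((2 : ℝ) • x - c) := by
      rw [smul_sub, smul_smul]; norm_num
    rw [this, norm_smul, Real.norm_of_nonneg (by norm_num)]
    linarith

theorem opNorm_le_of_half_net {E F : Type*} [NormedAddCommGroup E] [NormedSpace ℝ E]
    [NormedAddCommGroup F] [NormedSpace ℝ F] {N : Set E}
    (hN : ∀ x : E, ‖x‖ ≤ 1 → ∃ n ∈ N, ‖x - n‖ ≤ 1 / 2) (A : E →L[ℝ] F) {c : ℝ} (hc : 0 ≤ c)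
    (hA : ∀ n ∈ N, ‖A n‖ ≤ c) : ‖A‖ ≤ 2 * c := by
  have h : ‖A‖ ≤ c + ‖A‖ * (1 / 2) := by
    refine A.opNorm_le_of_unit_norm (by positivity) fun x hx => ?_
    obtain ⟨n, hn, hxn⟩ := hN x hx.le
    calc ‖A x‖ = ‖A n + A (x - n)‖ := by rw [map_sub]; congr 1; abel
      _ ≤ ‖A n‖ + ‖A (x - n)‖ := norm_add_le _ _
      _ ≤ c + ‖A‖ * (1 / 2) :=
        add_le_add (hA n hn) ((A.le_opNorm _).trans (by gcongr))
  linarith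

/-- If `A` almost preserves the norms of the sums and differences of the points of a net, then it
almost preserves all inner products. -/
theorem abs_inner_map_sub_inner_le_of_half_net {E F : Type*} [NormedAddCommGroup E]
    [InnerProductSpace ℝ E] [NormedAddCommGroup F] [InnerProductSpace ℝ F] {N : Set E}
    (hN1 : ∀ n ∈ N, ‖n‖ ≤ 1) (hN : ∀ x : E, ‖x‖ ≤ 1 → ∃ n ∈ N, ‖x - n‖ ≤ 1 / 2)
    (A : E →L[ℝ] F) {η : ℝ} (hη : 0 ≤ η)
    (hA : ∀ v ∈ N, ∀ w ∈ N, |‖A (v + w)‖ ^ 2 - ‖v + w‖ ^ 2| ≤ η * ‖v + w‖ ^ 2 ∧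
      |‖A (v - w)‖ ^ 2 - ‖v - w‖ ^ 2| ≤ η * ‖v - w‖ ^ 2) (x y : E) :
    |inner ℝ (A x) (A y) - inner ℝ x y| ≤ 4 * η * ‖x‖ * ‖y‖ := by
  let B : E →L[ℝ] E →L[ℝ] ℝ := (innerSL ℝ).bilinearComp A A - innerSL ℝ
  have hB : ∀ v w : E, B v w = inner ℝ (A v) (A w) - inner ℝ v w := fun v w => rfl
  have hBN : ∀ v ∈ N, ∀ w ∈ N, ‖B v w‖ ≤ η := by
    intro v hv w hw
    obtain ⟨h1, h2⟩ := hA v hv w hw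
    have hv1 := hN1 v hv
    have hw1 := hN1 w hw
    rw [map_add, norm_add_sq_real, norm_add_sq_real v w] at h1
    rw [map_sub, norm_sub_sq_real, norm_sub_sq_real v w] at h2
    rw [hB, Real.norm_eq_abs]
    have hvv : ‖v‖ * ‖v‖ ≤ 1 := by nlinarith [norm_nonneg v]
    have hww : ‖w‖ * ‖w‖ ≤ 1 := by nlinarith [norm_nonneg w]
    have hs : η * (‖v‖ ^ 2 + ‖w‖ ^ 2) ≤ η * 2 := by
      gcongr; nlinarith
    rw [abs_le] at h1 h2 ⊢
    constructor <;> nlinarith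
  have hBv : ∀ v ∈ N, ‖B v‖ ≤ 2 * η := fun v hv =>
    opNorm_le_of_half_net hN (B v) hη fun w hw => hBN v hv w hw
  have hBB : ‖B‖ ≤ 2 * (2 * η) := opNorm_le_of_half_net hN B (by positivity) hBv
  have h := B.le_opNorm₂ x y
  rw [hB, Real.norm_eq_abs] at h
  refine h.trans ?_
  rw [show 4 * η = 2 * (2 * η) by ring]
  gcongr

/-- The vectors of `ℝⁿ` that vanish off `T`. -/
def supportedOn {n : ℕ} (T : Finset (Fin n)) : Submodule ℝ (Vec n) where
  carrier := {x | ∀ i, i ∉ T → x i = 0}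
  add_mem' := fun {a b} ha hb i hi => by
    rw [PiLp.add_apply, ha i hi, hb i hi, add_zero]
  zero_mem' := fun i _ => rfl
  smul_mem' := fun c x hx i hi => by
    rw [PiLp.smul_apply, hx i hi, smul_zero]

theorem mem_supportedOn {n : ℕ} {T : Finset (Fin n)} {x : Vec n} :
    x ∈ supportedOn T ↔ ∀ i, i ∉ T → x i = 0 := Iff.rfl

theorem supportedOn_mono {n : ℕ} {S T : Finset (Fin n)} (h : S ⊆ T) :
    supportedOn S ≤ supportedOn T := fun _ hx i hi => hx i fun hS => hi (h hS)

theorem finrank_supportedOn_le {n : ℕ} (T : Finset (Fin n)) :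
    Module.finrank ℝ (supportedOn T) ≤ T.card := by
  let φ : supportedOn T →ₗ[ℝ] (T → ℝ) :=
    { toFun := fun x i => (x : Vec n) i
      map_add' := fun x y => rfl
      map_smul' := fun c x => rfl }
  have hφ : Function.Injective φ := by
    intro x y h
    ext i
    by_cases hi : i ∈ T
    · exact congrFun h ⟨i, hi⟩
    · rw [x.2 i hi, y.2 i hi]
  have := LinearMap.finrank_le_finrank_of_injective hφ
  simpa using this

variable {m n : ℕ}

/-- `Z` is close to an isometry, in the sense of bilinear forms and with error `δ`, on the vectors
supported on any set of at most `k` coordinates. -/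
def RestrictedIsometry (Z : Matrix (Fin m) (Fin n) ℝ) (k : ℕ) (δ : ℝ) : Prop :=
  ∀ T : Finset (Fin n), T.card ≤ k → ∀ x ∈ supportedOn T, ∀ y ∈ supportedOn T,
    |inner ℝ (Matrix.toEuclideanLin Z x) (Matrix.toEuclideanLin Z y) - inner ℝ x y| ≤
      δ * ‖x‖ * ‖y‖

/-- Near isometry on the vectors supported on `T` only has to be tested on finitely many vectors.
By polarization they are the sums and differences of the points of a net; the test is uniform in
the matrix. -/
theorem exists_test_vectors (T : Finset (Fin n)) :
    ∃ D : Finset (Vec n), D.card ≤ 2 * 25 ^ T.card ∧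
      ∀ (m : ℕ) (Z : Matrix (Fin m) (Fin n) ℝ) (η : ℝ), 0 ≤ η →
        (∀ u ∈ D, |‖Matrix.toEuclideanLin Z u‖ ^ 2 - ‖u‖ ^ 2| ≤ η * ‖u‖ ^ 2) →
        ∀ x ∈ supportedOn T, ∀ y ∈ supportedOn T,
          |inner ℝ (Matrix.toEuclideanLin Z x) (Matrix.toEuclideanLin Z y) - inner ℝ x y| ≤
            4 * η * ‖x‖ * ‖y‖ := by
  classical
  obtain ⟨N, hcard, hN1, hN⟩ := exists_half_net (supportedOn T)
  let D₁ : Finset (Vec n) := (N ×ˢ N).image fun q => (q.1 : Vec n) + q.2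
  let D₂ : Finset (Vec n) := (N ×ˢ N).image fun q => (q.1 : Vec n) - q.2
  have hNN : (N ×ˢ N).card ≤ 25 ^ T.card := by
    rw [Finset.card_product]
    calc N.card * N.card ≤ 5 ^ T.card * 5 ^ T.card := by
          have : N.card ≤ 5 ^ T.card :=
            hcard.trans (Nat.pow_le_pow_right (by norm_num) (finrank_supportedOn_le T))
          gcongr
      _ = 25 ^ T.card := by rw [← mul_pow]; norm_num
  refine ⟨D₁ ∪ D₂, ?_, ?_⟩
  · refine (Finset.card_union_le _ _).trans ?_
    have h1 : D₁.card ≤ 25 ^ T.card := Finset.card_image_le.trans hNN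
    have h2 : D₂.card ≤ 25 ^ T.card := Finset.card_image_le.trans hNN
    omega
  · intro m Z η hη hD x hx y hy
    let A : supportedOn T →L[ℝ] Vec m :=
      ((Matrix.toEuclideanLin Z).comp (supportedOn T).subtype).toContinuousLinearMap
    refine abs_inner_map_sub_inner_le_of_half_net (N := (N : Set _)) hN1 hN A hη ?_ ⟨x, hx⟩ ⟨y, hy⟩
    intro v hv w hw
    have hq : (v, w) ∈ N ×ˢ N := Finset.mem_product.2 ⟨hv, hw⟩
    exact ⟨hD _ (Finset.mem_union_left _ (Finset.mem_image.2 ⟨(v, w), hq, rfl⟩)),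
      hD _ (Finset.mem_union_right _ (Finset.mem_image.2 ⟨(v, w), hq, rfl⟩))⟩

end Nets

/-! ### Restricted isometry of random sign matrices -/

section SignMatrices

variable {m n : ℕ}

/-- The sign matrix encoded by a Boolean matrix. -/
def signMatrix (ε : Fin m → Fin n → Bool) : Matrix (Fin m) (Fin n) ℝ :=
  Matrix.of fun i l => boolSign (ε i l)

theorem norm_sq_signMatrix (ε : Fin m → Fin n → Bool) (u : Vec n) :
    ‖Matrix.toEuclideanLin ((1 / Real.sqrt m) • signMatrix ε) u‖ ^ 2 =
      (∑ i, signSum (fun l => u l) (ε i) ^ 2) / m := by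
  rw [EuclideanSpace.real_norm_sq_eq, Finset.sum_div]
  refine Finset.sum_congr rfl fun i _ => ?_
  have : Matrix.toEuclideanLin ((1 / Real.sqrt m) • signMatrix ε) u i =
      signSum (fun l => u l) (ε i) / Real.sqrt m := by
    simp only [Matrix.toLpLin_apply, Matrix.mulVec, dotProduct, Matrix.smul_apply, signMatrix,
      Matrix.of_apply, smul_eq_mul, signSum]
    rw [Finset.sum_div]
    exact Finset.sum_congr rfl fun l _ => by ring
  rw [this, div_pow, Real.sq_sqrt (Nat.cast_nonneg m)]

/-- A random sign matrix almost preserves the norm of a given vector. -/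
theorem card_norm_deviation_le (hm : 0 < m) (u : Vec n) :
    ((Finset.univ.filter fun ε : Fin m → Fin n → Bool =>
      1 / 40 * ‖u‖ ^ 2 <
        |‖Matrix.toEuclideanLin ((1 / Real.sqrt m) • signMatrix ε) u‖ ^ 2 - ‖u‖ ^ 2|).card : ℝ) ≤
      2 * (2 ^ n * Real.exp (-1 / 25000)) ^ m := by
  have hm' : (0 : ℝ) < m := by exact_mod_cast hm
  by_cases hu : u = 0
  · subst hu
    simp
    positivity
  have hn : 0 < ‖u‖ := norm_pos_iff.2 hu
  have hx : ∑ l, (u l / ‖u‖) ^ 2 = 1 := by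
    simp_rw [div_pow]
    rw [← Finset.sum_div, ← EuclideanSpace.real_norm_sq_eq]
    exact div_self (by positivity)
  have h := card_unit_deviation_le (m := m) (fun l => u l / ‖u‖) hx
  rw [Fintype.card_fin] at h
  refine le_trans ?_ h
  rw [Nat.cast_le]
  refine Finset.card_le_card fun ε hε => ?_
  simp only [Finset.mem_filter, Finset.mem_univ, true_and] at hε ⊢
  have hs : ∀ i, signSum (fun l => u l / ‖u‖) (ε i) ^ 2 =
      signSum (fun l => u l) (ε i) ^ 2 / ‖u‖ ^ 2 := by
    intro i
    rw [← div_pow]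
    congr 1
    rw [signSum, signSum, Finset.sum_div]
    exact Finset.sum_congr rfl fun l _ => by ring
  simp_rw [hs]
  rw [← Finset.sum_div]
  rw [norm_sq_signMatrix] at hε
  set Q := ∑ i, signSum (fun l => u l) (ε i) ^ 2
  have e : Q / ‖u‖ ^ 2 - m = (Q / m - ‖u‖ ^ 2) * (m / ‖u‖ ^ 2) := by
    field_simp
  rw [e, abs_mul, abs_of_pos (show 0 < m / ‖u‖ ^ 2 by positivity)]
  calc (m : ℝ) * (1 / 40) = 1 / 40 * ‖u‖ ^ 2 * (m / ‖u‖ ^ 2) := by field_simp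
    _ < _ := by gcongr

open Classical in
/-- The sign matrices that violate the restricted isometry property are few: take the union bound
over the test vectors of all sets of `min k n` coordinates. -/
theorem card_not_restrictedIsometry_le (hm : 0 < m) (k : ℕ) :
    ((Finset.univ.filter fun ε : Fin m → Fin n → Bool =>
      ¬ RestrictedIsometry ((1 / Real.sqrt m) • signMatrix ε) k (1 / 10)).card : ℝ) ≤
      (2 ^ n) ^ m * (4 * (25 * n) ^ min k n * Real.exp (-m / 25000)) := by
  choose D hDcard hD using fun T : Finset (Fin n) => exists_test_vectors T
  let bad : Vec n → Finset (Fin m → Fin n → Bool) := fun u =>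
    Finset.univ.filter fun ε : Fin m → Fin n → Bool =>
      1 / 40 * ‖u‖ ^ 2 <
        |‖Matrix.toEuclideanLin ((1 / Real.sqrt m) • signMatrix ε) u‖ ^ 2 - ‖u‖ ^ 2|
  have hsub : (Finset.univ.filter fun ε : Fin m → Fin n → Bool =>
      ¬ RestrictedIsometry ((1 / Real.sqrt m) • signMatrix ε) k (1 / 10)) ⊆
      ((Finset.univ : Finset (Fin n)).powersetCard (min k n)).biUnion fun T =>
        (D T).biUnion bad := by
    intro ε hε
    by_contra hcon
    refine (Finset.mem_filter.1 hε).2 fun T hT x hx y hy => ?_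
    obtain ⟨T', hTT', -, hT'⟩ := Finset.exists_subsuperset_card_eq (Finset.subset_univ T)
      (n := min k n) (le_min hT (by simpa using Finset.card_le_univ T)) (by simp)
    have hgood : ∀ u ∈ D T',
        |‖Matrix.toEuclideanLin ((1 / Real.sqrt m) • signMatrix ε) u‖ ^ 2 - ‖u‖ ^ 2| ≤
          1 / 40 * ‖u‖ ^ 2 := by
      intro u hu
      by_contra! hlt
      exact hcon (Finset.mem_biUnion.2 ⟨T', Finset.mem_powersetCard.2 ⟨Finset.subset_univ _, hT'⟩,
        Finset.mem_biUnion.2 ⟨u, hu, Finset.mem_filter.2 ⟨Finset.mem_univ _, hlt⟩⟩⟩)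
    have := hD T' m _ (1 / 40) (by norm_num) hgood x (supportedOn_mono hTT' hx) y
      (supportedOn_mono hTT' hy)
    norm_num at this ⊢
    exact this
  set P : ℝ := 2 * (2 ^ n * Real.exp (-1 / 25000)) ^ m with hP
  have hP0 : 0 ≤ P := by positivity
  have hbad : ∀ u, ((bad u).card : ℝ) ≤ P := fun u => card_norm_deviation_le hm u
  have h1 : ∀ T ∈ (Finset.univ : Finset (Fin n)).powersetCard (min k n),
      (((D T).biUnion bad).card : ℝ) ≤ 2 * 25 ^ min k n * P := by
    intro T hT
    have hTc := (Finset.mem_powersetCard.1 hT).2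
    calc (((D T).biUnion bad).card : ℝ) ≤ ∑ u ∈ D T, ((bad u).card : ℝ) := by
          exact_mod_cast Finset.card_biUnion_le
      _ ≤ ∑ _u ∈ D T, P := Finset.sum_le_sum fun u _ => hbad u
      _ = (D T).card * P := by simp
      _ ≤ 2 * 25 ^ min k n * P := by
          gcongr
          have := hDcard T
          rw [hTc] at this
          exact_mod_cast this
  calc _ ≤ ((((Finset.univ : Finset (Fin n)).powersetCard (min k n)).biUnion fun T =>
        (D T).biUnion bad).card : ℝ) := by exact_mod_cast Finset.card_le_card hsub
    _ ≤ ∑ T ∈ (Finset.univ : Finset (Fin n)).powersetCard (min k n),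
        (((D T).biUnion bad).card : ℝ) := by exact_mod_cast Finset.card_biUnion_le
    _ ≤ ∑ _T ∈ (Finset.univ : Finset (Fin n)).powersetCard (min k n), 2 * 25 ^ min k n * P :=
        Finset.sum_le_sum h1
    _ = (n.choose (min k n) : ℝ) * (2 * 25 ^ min k n * P) := by simp
    _ ≤ (n : ℝ) ^ min k n * (2 * 25 ^ min k n * P) := by
        gcongr
        exact_mod_cast Nat.choose_le_pow n _
    _ = _ := by
        rw [hP, mul_pow (2 ^ n : ℝ), ← Real.exp_nat_mul, mul_pow (25 : ℝ)]
        rw [show (m : ℝ) * (-1 / 25000) = -m / 25000 by ring]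
        ring

end SignMatrices

/-! ### Convergence of CoSaMP -/

section CoSaMP

variable {m n : ℕ}

theorem mem_supp {x : Vec n} {i : Fin n} : i ∈ supp x ↔ x i ≠ 0 := by simp [supp]

theorem supp_subset_iff {x : Vec n} {T : Finset (Fin n)} : supp x ⊆ T ↔ x ∈ supportedOn T := by
  simp only [Finset.subset_iff, mem_supp, mem_supportedOn]
  exact forall_congr' fun i => not_imp_comm

/-- The vector that agrees with `x` on `T` and vanishes off `T`. -/
def restrictTo (T : Finset (Fin n)) (x : Vec n) : Vec n :=
  WithLp.toLp 2 fun i => if i ∈ T then x i else 0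

theorem restrictTo_apply (T : Finset (Fin n)) (x : Vec n) (i : Fin n) :
    restrictTo T x i = if i ∈ T then x i else 0 := rfl

theorem restrictTo_mem (T : Finset (Fin n)) (x : Vec n) : restrictTo T x ∈ supportedOn T :=
  fun _ hi => if_neg hi

theorem restrictTo_sub (T : Finset (Fin n)) (x y : Vec n) :
    restrictTo T (x - y) = restrictTo T x - restrictTo T y := by
  ext i
  simp only [restrictTo_apply, PiLp.sub_apply]
  split_ifs <;> simp

theorem norm_sq_restrictTo (T : Finset (Fin n)) (x : Vec n) :
    ‖restrictTo T x‖ ^ 2 = ∑ i ∈ T, x i ^ 2 := by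
  rw [EuclideanSpace.real_norm_sq_eq]
  simp [restrictTo_apply, ite_pow, Finset.sum_ite_mem]

theorem inner_restrictTo_self (T : Finset (Fin n)) (x : Vec n) :
    inner ℝ (restrictTo T x) x = ‖restrictTo T x‖ ^ 2 := by
  rw [norm_sq_restrictTo, PiLp.inner_apply]
  simp [restrictTo_apply, Finset.sum_ite_mem, sq]

theorem norm_le_of_abs_le {x y : Vec n} (h : ∀ i, |x i| ≤ |y i|) : ‖x‖ ≤ ‖y‖ := by
  rw [← sq_le_sq₀ (norm_nonneg _) (norm_nonneg _), EuclideanSpace.real_norm_sq_eq,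
    EuclideanSpace.real_norm_sq_eq]
  exact Finset.sum_le_sum fun i _ => sq_le_sq.2 (h i)

/-- Among the sets of a given size, those that carry the largest entries maximize the sum of
squares. -/
theorem sum_sq_sdiff_le {u : Vec n} {S V : Finset (Fin n)} (hcard : V.card ≤ S.card)
    (hS : ∀ a ∈ S, ∀ b ∉ S, |u b| ≤ |u a|) :
    ∑ i ∈ V \ S, u i ^ 2 ≤ ∑ i ∈ S \ V, u i ^ 2 := by
  have hc : (V \ S).card ≤ (S \ V).card := Finset.card_sdiff_le_card_sdiff_iff.2 hcard
  rcases (S \ V).eq_empty_or_nonempty with h | h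
  · have : V \ S = ∅ := by
      rw [h, Finset.card_empty] at hc
      exact Finset.card_eq_zero.1 (Nat.le_zero.1 hc)
    rw [h, this]
  · obtain ⟨a, ha, hmin⟩ := (S \ V).exists_min_image (fun i => u i ^ 2) h
    have h1 : ∑ i ∈ V \ S, u i ^ 2 ≤ (V \ S).card • u a ^ 2 :=
      Finset.sum_le_card_nsmul _ _ _ fun i hi =>
        sq_le_sq.2 (hS a (Finset.mem_sdiff.1 ha).1 i (Finset.mem_sdiff.1 hi).2)
    have h2 : (S \ V).card • u a ^ 2 ≤ ∑ i ∈ S \ V, u i ^ 2 :=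
      Finset.card_nsmul_le_sum _ _ _ hmin
    exact h1.trans ((nsmul_le_nsmul_left (sq_nonneg _) hc).trans h2)

theorem IsBestApprox.card_supp_le {k : ℕ} {u w : Vec n} (h : IsBestApprox k u w) :
    (supp w).card ≤ k := by
  obtain ⟨S, hS, -, hw⟩ := h
  refine (Finset.card_le_card fun i hi => ?_).trans (hS.le.trans (min_le_left _ _))
  by_contra hiS
  exact mem_supp.1 hi (by rw [hw, if_neg hiS])

/-- A best approximation captures at least as much of `u` as the restriction to any other admissible
set `V` of coordinates. The selected set may exceed the support of `w` only by zeros of `u`. -/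
theorem IsBestApprox.norm_restrictTo_sdiff_le {k : ℕ} {u w : Vec n} (h : IsBestApprox k u w)
    {V : Finset (Fin n)} (hV : V.card ≤ k) :
    ‖restrictTo (V \ supp w) u‖ ≤ ‖restrictTo (supp w \ V) u‖ := by
  obtain ⟨S, hS, hmax, hw⟩ := h
  have hsub : supp w ⊆ S := fun i hi => by
    by_contra hiS
    exact mem_supp.1 hi (by rw [hw, if_neg hiS])
  have hzero : ∀ i ∈ S, i ∉ supp w → u i = 0 := by
    intro i hi hiw
    rw [mem_supp, not_not, hw, if_pos hi] at hiw
    exact hiw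
  have h1 := sum_sq_sdiff_le (u := u) (S := S) (V := V)
    (hS ▸ le_min hV (by simpa using Finset.card_le_univ V)) hmax
  have h2 : ∑ i ∈ V \ S, u i ^ 2 = ∑ i ∈ V \ supp w, u i ^ 2 := by
    refine Finset.sum_subset (Finset.sdiff_subset_sdiff le_rfl hsub) fun i hi hi' => ?_
    simp only [Finset.mem_sdiff] at hi hi'
    rw [hzero i (by tauto) hi.2]
    norm_num
  have h3 : ∑ i ∈ supp w \ V, u i ^ 2 = ∑ i ∈ S \ V, u i ^ 2 := by
    refine Finset.sum_subset (Finset.sdiff_subset_sdiff hsub le_rfl) fun i hi hi' => ?_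
    simp only [Finset.mem_sdiff] at hi hi'
    rw [hzero i hi.1 (by tauto)]
    norm_num
  rw [← sq_le_sq₀ (norm_nonneg _) (norm_nonneg _), norm_sq_restrictTo, norm_sq_restrictTo, ← h2, h3]
  exact h1

/-- A best `k`-term approximation is at most as far away as any vector with `k` non-zero entries. -/
theorem IsBestApprox.norm_sub_le {k : ℕ} {b a v : Vec n} (h : IsBestApprox k b a)
    (hv : (supp v).card ≤ k) : ‖b - a‖ ≤ ‖b - v‖ := by
  obtain ⟨S, hS, hmax, ha⟩ := h
  have h1 := sum_sq_sdiff_le (u := b) (S := S) (V := supp v)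
    (hS ▸ le_min hv (by simpa using Finset.card_le_univ (supp v))) hmax
  have e1 : ‖b - a‖ ^ 2 = ∑ i ∈ Sᶜ, b i ^ 2 := by
    rw [EuclideanSpace.real_norm_sq_eq, ← Finset.sum_add_sum_compl S]
    rw [Finset.sum_eq_zero fun i hi => by rw [PiLp.sub_apply, ha, if_pos hi]; ring, zero_add]
    exact Finset.sum_congr rfl fun i hi => by
      rw [PiLp.sub_apply, ha, if_neg (Finset.mem_compl.1 hi)]; ring
  have e2 : ∑ i ∈ (supp v)ᶜ, b i ^ 2 ≤ ‖b - v‖ ^ 2 := by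
    rw [EuclideanSpace.real_norm_sq_eq]
    calc ∑ i ∈ (supp v)ᶜ, b i ^ 2 = ∑ i ∈ (supp v)ᶜ, (b - v) i ^ 2 := by
          refine Finset.sum_congr rfl fun i hi => ?_
          rw [Finset.mem_compl, mem_supp, not_not] at hi
          rw [PiLp.sub_apply, hi, sub_zero]
      _ ≤ _ := Finset.sum_le_sum_of_subset_of_nonneg (Finset.subset_univ _)
          fun _ _ _ => sq_nonneg _
  have e3 : ∑ i ∈ Sᶜ, b i ^ 2 = ∑ i ∈ Sᶜ \ supp v, b i ^ 2 + ∑ i ∈ supp v \ S, b i ^ 2 := by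
    rw [← Finset.sum_inter_add_sum_sdiff Sᶜ (supp v), add_comm]
    congr 2
    ext i; simp [and_comm]
  have e4 : ∑ i ∈ (supp v)ᶜ, b i ^ 2 =
      ∑ i ∈ Sᶜ \ supp v, b i ^ 2 + ∑ i ∈ S \ supp v, b i ^ 2 := by
    rw [← Finset.sum_inter_add_sum_sdiff (supp v)ᶜ S, add_comm]
    congr 2
    · ext i; simp [and_comm]
    · ext i; simp [and_comm]
  rw [← sq_le_sq₀ (norm_nonneg _) (norm_nonneg _), e1]
  linarith

/-- If no multiple of `g` brings `w` closer to `0`, then `w` and `g` are orthogonal. -/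
theorem inner_eq_zero_of_norm_le {E : Type*} [NormedAddCommGroup E] [InnerProductSpace ℝ E]
    {w g : E} (h : ∀ t : ℝ, ‖w‖ ≤ ‖w - t • g‖) : inner ℝ w g = (0 : ℝ) := by
  -- adding `1` to the optimal denominator `‖g‖ ^ 2` avoids a case distinction on `g = 0`
  have h1 := h (inner ℝ w g / (‖g‖ ^ 2 + 1))
  rw [← sq_le_sq₀ (norm_nonneg _) (norm_nonneg _), norm_sub_sq_real, real_inner_smul_right,
    norm_smul, mul_pow, Real.norm_eq_abs, sq_abs] at h1
  set c : ℝ := inner ℝ w g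
  have hG : 0 < ‖g‖ ^ 2 + 1 := by positivity
  have h2 : 2 * (c / (‖g‖ ^ 2 + 1) * c) ≤ (c / (‖g‖ ^ 2 + 1)) ^ 2 * ‖g‖ ^ 2 := by linarith
  have e1 : 2 * (c / (‖g‖ ^ 2 + 1) * c) = 2 * c ^ 2 * (‖g‖ ^ 2 + 1) / (‖g‖ ^ 2 + 1) ^ 2 := by
    field_simp
  have e2 : (c / (‖g‖ ^ 2 + 1)) ^ 2 * ‖g‖ ^ 2 = c ^ 2 * ‖g‖ ^ 2 / (‖g‖ ^ 2 + 1) ^ 2 := by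
    field_simp
  rw [e1, e2, div_le_div_iff_of_pos_right (by positivity)] at h2
  have : c ^ 2 ≤ 0 := by nlinarith [sq_nonneg c, sq_nonneg ‖g‖, mul_nonneg (sq_nonneg c) (sq_nonneg ‖g‖)]
  exact pow_eq_zero_iff (two_ne_zero) |>.1 (le_antisymm this (sq_nonneg c))

/-- The normal equations. -/
theorem IsLeastSquares.inner_eq_zero {Z : Matrix (Fin m) (Fin n) ℝ} {y : Vec m}
    {T : Finset (Fin n)} {b : Vec n} (h : IsLeastSquares Z y T b) {c : Vec n}
    (hc : c ∈ supportedOn T) :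
    inner ℝ (y - Matrix.toEuclideanLin Z b) (Matrix.toEuclideanLin Z c) = (0 : ℝ) := by
  refine inner_eq_zero_of_norm_le fun t => ?_
  have hb := supp_subset_iff.1 h.1
  have := h.2 (b + t • c) (supp_subset_iff.2
    (Submodule.add_mem _ hb (Submodule.smul_mem _ t hc)))
  rwa [map_add, map_smul, ← sub_sub] at this

theorem inner_transpose (Z : Matrix (Fin m) (Fin n) ℝ) (x : Vec n) (y : Vec m) :
    inner ℝ x (Matrix.toEuclideanLin Z.transpose y) =
      (inner ℝ (Matrix.toEuclideanLin Z x) y : ℝ) := by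
  rw [← Matrix.conjTranspose_eq_transpose_of_trivial, Matrix.toEuclideanLin_conjTranspose_eq_adjoint,
    LinearMap.adjoint_inner_right]

variable {Z : Matrix (Fin m) (Fin n) ℝ} {k : ℕ}

theorem RestrictedIsometry.norm_sq_sub_le (hZ : RestrictedIsometry Z k (1 / 10))
    {T : Finset (Fin n)} (hT : T.card ≤ k) {x : Vec n} (hx : x ∈ supportedOn T) :
    |‖Matrix.toEuclideanLin Z x‖ ^ 2 - ‖x‖ ^ 2| ≤ 1 / 10 * ‖x‖ ^ 2 := by
  have := hZ T hT x hx x hx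
  rwa [real_inner_self_eq_norm_sq, real_inner_self_eq_norm_sq, mul_assoc, ← sq] at this

theorem RestrictedIsometry.norm_le (hZ : RestrictedIsometry Z k (1 / 10))
    {T : Finset (Fin n)} (hT : T.card ≤ k) {x : Vec n} (hx : x ∈ supportedOn T) :
    ‖Matrix.toEuclideanLin Z x‖ ≤ 1.05 * ‖x‖ := by
  have := (abs_le.1 (hZ.norm_sq_sub_le hT hx)).2
  rw [← sq_le_sq₀ (norm_nonneg _) (by positivity)]
  nlinarith [sq_nonneg ‖x‖]

/-- On few coordinates `D`, the proxy `Zᵀ (Z r + e)` is close to the sparse vector `r`. -/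
theorem RestrictedIsometry.norm_restrictTo_proxy_sub_le (hZ : RestrictedIsometry Z k (1 / 10))
    {T D : Finset (Fin n)} (hT : T.card ≤ k) {r : Vec n} (hr : r ∈ supportedOn T) (hD : D ⊆ T)
    (e : Vec m) :
    ‖restrictTo D (Matrix.toEuclideanLin Z.transpose (Matrix.toEuclideanLin Z r + e) - r)‖ ≤
      1 / 10 * ‖r‖ + 1.05 * ‖e‖ := by
  set q := Matrix.toEuclideanLin Z.transpose (Matrix.toEuclideanLin Z r + e) - r with hq
  set h := restrictTo D q with hh
  have hhT : h ∈ supportedOn T := supportedOn_mono hD (restrictTo_mem D _)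
  have e1 : ‖h‖ ^ 2 = (inner ℝ (Matrix.toEuclideanLin Z h) (Matrix.toEuclideanLin Z r) -
      inner ℝ h r) + inner ℝ (Matrix.toEuclideanLin Z h) e := by
    rw [hh, ← inner_restrictTo_self, ← hh, hq, inner_sub_right, inner_transpose, inner_add_right]
    ring
  have b1 := (abs_le.1 (hZ T hT h hhT r hr)).2
  have b2 : inner ℝ (Matrix.toEuclideanLin Z h) e ≤ 1.05 * ‖h‖ * ‖e‖ :=
    (real_inner_le_norm _ _).trans (by gcongr; exact hZ.norm_le hT hhT)
  rcases eq_or_lt_of_le (norm_nonneg h) with h0 | h0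
  · rw [← h0]; positivity
  · refine le_of_mul_le_mul_left ?_ h0
    nlinarith

/-- One iteration of CoSaMP halves the error, up to the noise. -/
theorem CoSaMPStep.norm_sub_le {s : ℕ} (hZ : RestrictedIsometry Z (4 * s) (1 / 10))
    {v a a' : Vec n} {e : Vec m} (hv : (supp v).card ≤ s) (ha : (supp a).card ≤ s)
    (h : CoSaMPStep Z (Matrix.toEuclideanLin Z v + e) s a a') :
    (supp a').card ≤ s ∧ ‖a' - v‖ ≤ 1 / 2 * ‖a - v‖ + 8 * ‖e‖ := by
  obtain ⟨w, b, hw, hb, hpr⟩ := h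
  refine ⟨hpr.card_supp_le, ?_⟩
  set r := v - a with hrdef
  have hrR : r ∈ supportedOn (supp r) := supp_subset_iff.1 le_rfl
  have hR : (supp r).card ≤ 2 * s := by
    have hsub : supp r ⊆ supp v ∪ supp a := by
      intro i hi
      rw [mem_supp, hrdef, PiLp.sub_apply] at hi
      rw [Finset.mem_union, mem_supp, mem_supp]
      by_contra! hcon
      rw [hcon.1, hcon.2, sub_zero] at hi
      exact hi rfl
    have := (Finset.card_le_card hsub).trans (Finset.card_union_le _ _)
    omega
  have hy : Matrix.toEuclideanLin Z v + e - Matrix.toEuclideanLin Z a =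
      Matrix.toEuclideanLin Z r + e := by rw [hrdef, map_sub]; abel
  rw [hy] at hw
  set u := Matrix.toEuclideanLin Z.transpose (Matrix.toEuclideanLin Z r + e) with hu
  have hW := hw.card_supp_le
  -- identification: the merged support captures most of the current residual `r`
  have ident : ‖restrictTo (supp r \ supp w) r‖ ≤ 2 * (1 / 10 * ‖r‖ + 1.05 * ‖e‖) := by
    have hT : (supp r ∪ supp w).card ≤ 4 * s := (Finset.card_union_le _ _).trans (by omega)
    have hrT : r ∈ supportedOn (supp r ∪ supp w) :=
      supportedOn_mono Finset.subset_union_left hrR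
    have p1 := hZ.norm_restrictTo_proxy_sub_le hT hrT (D := supp r \ supp w)
      (Finset.sdiff_subset.trans Finset.subset_union_left) e
    have p2 := hZ.norm_restrictTo_proxy_sub_le hT hrT (D := supp w \ supp r)
      (Finset.sdiff_subset.trans Finset.subset_union_right) e
    rw [← hu, restrictTo_sub] at p1 p2
    have z : restrictTo (supp w \ supp r) r = 0 := by
      ext i
      rw [restrictTo_apply]
      split_ifs with hi
      · exact not_not.1 fun h => (Finset.mem_sdiff.1 hi).2 (mem_supp.2 h)
      · rfl
    rw [z, sub_zero] at p2
    have p3 := hw.norm_restrictTo_sdiff_le hR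
    have p4 := norm_sub_norm_le (restrictTo (supp r \ supp w) r) (restrictTo (supp r \ supp w) u)
    rw [norm_sub_rev] at p4
    linarith
  set T := supp w ∪ supp a with hT
  have hTc : T.card ≤ 3 * s := (Finset.card_union_le _ _).trans (by omega)
  set t := v - restrictTo T v with ht
  have htr : ‖t‖ ≤ ‖restrictTo (supp r \ supp w) r‖ := by
    refine norm_le_of_abs_le fun i => ?_
    rw [ht, PiLp.sub_apply, restrictTo_apply, restrictTo_apply]
    by_cases hi : i ∈ T
    · rw [if_pos hi]; simp
    · rw [if_neg hi]
      rw [hT, Finset.mem_union, not_or, mem_supp (x := a), not_not] at hi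
      have hvr : v i = r i := by rw [hrdef, PiLp.sub_apply, hi.2, sub_zero]
      by_cases hri : r i = 0
      · simp [hvr, hri]
      · rw [if_pos (Finset.mem_sdiff.2 ⟨mem_supp.2 hri, hi.1⟩), hvr, sub_zero]
  -- least squares: the error on the merged support is governed by the part of `v` missed by it
  set q := restrictTo T v - b with hq
  have hqT : q ∈ supportedOn T :=
    Submodule.sub_mem _ (restrictTo_mem T v) (supp_subset_iff.1 hb.1)
  have hT4 : (T ∪ supp v).card ≤ 4 * s := (Finset.card_union_le _ _).trans (by omega)
  have hqT4 := supportedOn_mono (Finset.subset_union_left (s₂ := supp v)) hqT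
  have hvT4 : v ∈ supportedOn (T ∪ supp v) :=
    supp_subset_iff.1 Finset.subset_union_right
  have htT4 : t ∈ supportedOn (T ∪ supp v) :=
    Submodule.sub_mem _ hvT4 (supportedOn_mono Finset.subset_union_left (restrictTo_mem T v))
  have htq : inner ℝ t q = (0 : ℝ) := by
    rw [PiLp.inner_apply]
    refine Finset.sum_eq_zero fun i _ => ?_
    by_cases hi : i ∈ T
    · simp [ht, restrictTo_apply, hi]
    · simp [hqT i hi]
  have normal := hb.inner_eq_zero hqT
  have hres : Matrix.toEuclideanLin Z v + e - Matrix.toEuclideanLin Z b =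
      Matrix.toEuclideanLin Z q + Matrix.toEuclideanLin Z t + e := by
    rw [hq, ht, map_sub, map_sub]; abel
  rw [hres, inner_add_left, inner_add_left, real_inner_self_eq_norm_sq] at normal
  have hqn : ‖q‖ ≤ 1 / 9 * ‖t‖ + 1.17 * ‖e‖ := by
    have b1 := (abs_le.1 (hZ _ hT4 t htT4 q hqT4)).1
    have b2 := (abs_le.1 (hZ.norm_sq_sub_le hT4 hqT4)).1
    have b3 : -(inner ℝ e (Matrix.toEuclideanLin Z q)) ≤ ‖e‖ * (1.05 * ‖q‖) := by
      rw [← inner_neg_left]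
      refine (real_inner_le_norm _ _).trans ?_
      rw [norm_neg]
      gcongr
      exact hZ.norm_le hT4 hqT4
    rw [htq] at b1
    rcases eq_or_lt_of_le (norm_nonneg q) with h0 | h0
    · rw [← h0]; positivity
    · refine le_of_mul_le_mul_left ?_ h0
      nlinarith [mul_nonneg (norm_nonneg e) (norm_nonneg q)]
  have hbv : ‖b - v‖ ≤ ‖q‖ + ‖t‖ := by
    have : b - v = -(q + t) := by rw [hq, ht]; abel
    rw [this, norm_neg]
    exact norm_add_le _ _
  -- pruning costs at most a factor of two
  have hprune := hpr.norm_sub_le hv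
  have htri : ‖a' - v‖ ≤ ‖b - a'‖ + ‖b - v‖ := by
    rw [norm_sub_rev b a']
    exact norm_sub_le_norm_sub_add_norm_sub _ _ _
  have hra : ‖r‖ = ‖a - v‖ := norm_sub_rev _ _
  rw [← hra]
  have := norm_nonneg r
  have := norm_nonneg e
  linarith

/-- Error bound for CoSaMP: the errors of the single iterations form a geometric series. -/
theorem IsCoSaMPOutput.norm_sub_le {s N : ℕ} (hZ : RestrictedIsometry Z (4 * s) (1 / 10))
    {v a : Vec n} {e : Vec m} (hv : (supp v).card ≤ s)
    (h : IsCoSaMPOutput Z (Matrix.toEuclideanLin Z v + e) s N a) :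
    ‖a - v‖ ≤ (1 / 2) ^ N * ‖v‖ + 16 * ‖e‖ := by
  obtain ⟨x, hx0, hstep, rfl⟩ := h
  have key : ∀ j ≤ N, (supp (x j)).card ≤ s ∧ ‖x j - v‖ ≤ (1 / 2) ^ j * ‖v‖ + 16 * ‖e‖ := by
    intro j
    induction j with
    | zero =>
      intro _
      rw [hx0]
      refine ⟨by simp [supp], ?_⟩
      rw [zero_sub, norm_neg, pow_zero, one_mul]
      linarith [norm_nonneg e]
    | succ j ih =>
      intro hj
      obtain ⟨h1, h2⟩ := ih (by omega)
      obtain ⟨h3, h4⟩ := (hstep j (by omega)).norm_sub_le hZ hv h1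
      refine ⟨h3, h4.trans ?_⟩
      rw [pow_succ]
      linarith
  exact (key N le_rfl).2

end CoSaMP

/-! ### Finite differences as noisy linear measurements -/

section Taylor

/-- Taylor's formula of order two, for a gradient that is differentiable but need not be
continuously differentiable: integrate the bound on the second derivative twice. -/
theorem abs_sub_sub_inner_gradient_le {n : ℕ} {f : Vec n → ℝ} (hf : Differentiable ℝ f)
    {x h : Vec n} {M : ℝ} (hg : ∀ y ∈ segment ℝ x (x + h), DifferentiableAt ℝ (gradient f) y)
    (hM : ∀ y ∈ segment ℝ x (x + h),
      |inner ℝ (fderiv ℝ (gradient f) y h) h| ≤ M) :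
    |f (x + h) - f x - inner ℝ (gradient f x) h| ≤ M / 2 := by
  have hline : ∀ t : ℝ, HasDerivAt (fun t : ℝ => x + t • h) h t := fun t => by
    simpa using ((hasDerivAt_id t).smul_const h).const_add x
  have hseg : ∀ t ∈ Set.Icc (0 : ℝ) 1, x + t • h ∈ segment ℝ x (x + h) := by
    intro t ht
    rw [segment_eq_image']
    exact ⟨t, ht, by simp⟩
  have hd1 : ∀ t : ℝ, HasDerivAt (fun t : ℝ => f (x + t • h))
      (inner ℝ (gradient f (x + t • h)) h) t := by
    intro t
    have : HasDerivAt (fun t : ℝ => f (x + t • h)) _ t :=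
      (hf (x + t • h)).hasGradientAt.hasFDerivAt.comp_hasDerivAt t (hline t)
    exact this.congr_deriv (by simp)
  have hd2 : ∀ t ∈ Set.Icc (0 : ℝ) 1,
      HasDerivAt (fun t : ℝ => (inner ℝ (gradient f (x + t • h)) h : ℝ))
        (inner ℝ (fderiv ℝ (gradient f) (x + t • h) h) h) t := by
    intro t ht
    have h1 := (hg _ (hseg t ht)).hasFDerivAt.comp_hasDerivAt t (hline t)
    have h2 := h1.inner ℝ (hasDerivAt_const t h)
    simpa using h2
  have hfirst : ∀ t ∈ Set.Icc (0 : ℝ) 1,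
      ‖inner ℝ (gradient f (x + t • h)) h - inner ℝ (gradient f x) h‖ ≤ M * t := by
    have := norm_image_sub_le_of_norm_deriv_le_segment' (a := 0) (b := 1) (C := M)
      (fun t ht => (hd2 t ht).hasDerivWithinAt)
      (fun t ht => hM _ (hseg t ⟨ht.1, ht.2.le⟩))
    simpa using this
  have hsecond := image_norm_le_of_norm_deriv_right_le_deriv_boundary (a := 0) (b := 1)
    (f := fun t : ℝ => f (x + t • h) - f x - t * inner ℝ (gradient f x) h)
    (f' := fun t : ℝ => inner ℝ (gradient f (x + t • h)) h - inner ℝ (gradient f x) h)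
    (B := fun t => M / 2 * t ^ 2) (B' := fun t => M * t)
    (fun t _ => by
      have := ((hd1 t).sub_const (f x)).sub
        ((hasDerivAt_id t).mul_const (inner ℝ (gradient f x) h : ℝ))
      exact (this.continuousAt).continuousWithinAt)
    (fun t _ => by
      have := ((hd1 t).sub_const (f x)).sub
        ((hasDerivAt_id t).mul_const (inner ℝ (gradient f x) h : ℝ))
      rw [one_mul] at this
      exact this.hasDerivWithinAt)
    (by simp)
    (fun t => by
      have := (hasDerivAt_pow 2 t).const_mul (M / 2)
      refine this.congr_deriv ?_
      push_cast
      ring)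
    (fun t ht => hfirst t ⟨ht.1, ht.2.le⟩)
  have := hsecond (show (1 : ℝ) ∈ Set.Icc (0 : ℝ) 1 by simp)
  simpa using this

variable {J p : ℕ}

theorem blockEmbed_smul (π : Equiv.Perm (Fin (J * p))) (j : Fin J) (c : ℝ) (t : Vec p) :
    blockEmbed π j (c • t) = c • blockEmbed π j t := by
  simp [blockEmbed, Finset.smul_sum, smul_smul]

theorem inner_blockEmbed (π : Equiv.Perm (Fin (J * p))) (j : Fin J) (w : Vec (J * p)) (t : Vec p) :
    inner ℝ w (blockEmbed π j t) = ∑ l, t l * w (blockIndex π j l) := by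
  rw [blockEmbed, inner_sum]
  refine Finset.sum_congr rfl fun l _ => ?_
  rw [real_inner_smul_right, EuclideanSpace.inner_single_right]
  simp

theorem abs_inner_hessian_blockEmbed_le {f : Vec (J * p) → ℝ} (π : Equiv.Perm (Fin (J * p)))
    (j : Fin J) (y : Vec (J * p)) {t : Vec p} {δ : ℝ} (ht : ∀ l, |t l| = δ) :
    |inner ℝ (fderiv ℝ (gradient f) y (blockEmbed π j t)) (blockEmbed π j t)| ≤
      δ ^ 2 * blockHessianL1 f π j y := by
  have e : ∀ k, fderiv ℝ (gradient f) y (blockEmbed π j t) (blockIndex π j k) =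
      ∑ l, t l * hessianEntry f y (blockIndex π j k) (blockIndex π j l) := by
    intro k
    rw [blockEmbed, map_sum, WithLp.ofLp_sum, Finset.sum_apply]
    refine Finset.sum_congr rfl fun l _ => ?_
    rw [map_smul]
    rfl
  rw [inner_blockEmbed, blockHessianL1, Finset.mul_sum]
  refine (Finset.abs_sum_le_sum_abs _ _).trans (Finset.sum_le_sum fun k _ => ?_)
  rw [e, Finset.mul_sum, Finset.mul_sum]
  refine (Finset.abs_sum_le_sum_abs _ _).trans (Finset.sum_le_sum fun l _ => le_of_eq ?_)
  rw [abs_mul, abs_mul, ht, ht]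
  ring

/-- The finite differences are noisy linear measurements of the block gradient. For the radius
`δ = 2 √(σ / H)`, the Taylor remainder and the oracle noise contribute at most `√(σ H)` each. -/
theorem measurements_eq_add_error {m : ℕ} {f : Vec (J * p) → ℝ} {X : Set (Vec (J * p))}
    {H σ δ : ℝ} (hf : Differentiable ℝ f) (hX : WeaklySparseHessian f X H) (hH : 0 < H)
    (hσ : 0 < σ) (hδ : δ = 2 * Real.sqrt (σ / H)) {x : Vec (J * p)}
    (π : Equiv.Perm (Fin (J * p))) (j : Fin J)
    (hseg : ∀ t : Vec p, (∀ l, |t l| = δ) → segment ℝ x (x + blockEmbed π j t) ⊆ X)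
    {z : Matrix (Fin m) (Fin p) ℝ} (hz : ∀ i l, |z i l| = 1) {ξ : QueryLabel m → ℝ}
    (hξ : ∀ q, |ξ q| ≤ σ) :
    ∃ e : Vec m, measurements f π j x δ z ξ =
        Matrix.toEuclideanLin ((1 / Real.sqrt m) • z) (blockGrad f π j x) + e ∧
      ‖e‖ ≤ 2 * Real.sqrt (σ * H) := by
  have hδ0 : 0 < δ := by rw [hδ]; positivity
  have hδ2 : δ ^ 2 = 4 * σ / H := by
    rw [hδ, mul_pow, Real.sq_sqrt (by positivity)]; ring
  refine ⟨measurements f π j x δ z ξ -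
    Matrix.toEuclideanLin ((1 / Real.sqrt m) • z) (blockGrad f π j x), by abel, ?_⟩
  rcases Nat.eq_zero_or_pos m with rfl | hm
  · rw [Subsingleton.elim (measurements f π j x δ z ξ -
      Matrix.toEuclideanLin ((1 / Real.sqrt (0 : ℕ)) • z) (blockGrad f π j x)) 0, norm_zero]
    positivity
  have hm' : (0 : ℝ) < m := by exact_mod_cast hm
  have hsm : 0 < Real.sqrt m := Real.sqrt_pos.2 hm'
  rw [← sq_le_sq₀ (norm_nonneg _) (by positivity), EuclideanSpace.real_norm_sq_eq, mul_pow,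
    Real.sq_sqrt (by positivity)]
  have hi : ∀ i, (measurements f π j x δ z ξ -
      Matrix.toEuclideanLin ((1 / Real.sqrt m) • z) (blockGrad f π j x)) i ^ 2 ≤
      4 * σ * H / m := by
    intro i
    set t : Vec p := δ • WithLp.toLp 2 (z i) with ht
    have htl : ∀ l, |t l| = δ := by
      intro l
      rw [ht, PiLp.smul_apply, smul_eq_mul, abs_mul, hz, mul_one, abs_of_pos hδ0]
    have htaylor := abs_sub_sub_inner_gradient_le hf (x := x) (h := blockEmbed π j t)
      (M := δ ^ 2 * H) (fun y hy => hX.1 y (hseg t htl hy))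
      (fun y hy => (abs_inner_hessian_blockEmbed_le π j y htl).trans
        (mul_le_mul_of_nonneg_left (hX.2 π j y (hseg t htl hy)) (sq_nonneg δ)))
    rw [inner_blockEmbed, hδ2, div_mul_cancel₀ _ hH.ne'] at htaylor
    have hlin : Matrix.toEuclideanLin ((1 / Real.sqrt m) • z) (blockGrad f π j x) i =
        (∑ l, t l * gradient f x (blockIndex π j l)) / (Real.sqrt m * δ) := by
      simp only [Matrix.toLpLin_apply, Matrix.mulVec, dotProduct, Matrix.smul_apply, smul_eq_mul,
        blockGrad, ht, PiLp.smul_apply]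
      rw [Finset.sum_div]
      refine Finset.sum_congr rfl fun l _ => ?_
      field_simp
    have hq : queryPoint π j x δ z (i, true) = x + blockEmbed π j t := by
      rw [ht, blockEmbed_smul]; rfl
    have hq' : queryPoint π j x δ z (i, false) = x := rfl
    have he : (measurements f π j x δ z ξ -
        Matrix.toEuclideanLin ((1 / Real.sqrt m) • z) (blockGrad f π j x)) i =
        ((f (x + blockEmbed π j t) - f x - ∑ l, t l * gradient f x (blockIndex π j l)) +
          ξ (i, true) - ξ (i, false)) / (Real.sqrt m * δ) := by
      rw [PiLp.sub_apply, hlin]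
      simp only [measurements, hq, hq']
      ring
    have hnum : ((f (x + blockEmbed π j t) - f x - ∑ l, t l * gradient f x (blockIndex π j l)) +
          ξ (i, true) - ξ (i, false)) ^ 2 ≤ (4 * σ) ^ 2 := by
      have h1 := abs_le.1 (hξ (i, true))
      have h2 := abs_le.1 (hξ (i, false))
      rw [abs_le] at htaylor
      apply sq_le_sq'
      · linarith [htaylor.1, h1.1, h2.2]
      · linarith [htaylor.2, h1.2, h2.1]
    rw [he, div_pow, mul_pow, Real.sq_sqrt hm'.le, hδ2]
    refine (div_le_div_of_nonneg_right hnum (by positivity)).trans (le_of_eq ?_)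
    field_simp
  refine (Finset.sum_le_sum fun i _ => hi i).trans (le_of_eq ?_)
  rw [Finset.sum_const, Finset.card_univ, Fintype.card_fin, nsmul_eq_mul]
  field_simp
  ring

end Taylor

/-! ### Probabilities of the exceptional events -/

section Probability

variable {Ω : Type*} [MeasurableSpace Ω] {μ : Measure Ω}

theorem IsUniformPerm.measure_preimage_le {n : ℕ} {U : Ω → Equiv.Perm (Fin n)}
    (hU : IsUniformPerm U μ) (F : Finset (Equiv.Perm (Fin n))) :
    μ {ω | U ω ∈ F} ≤ ENNReal.ofReal (F.card / n.factorial) := by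
  have h : {ω | U ω ∈ F} = ⋃ π ∈ F, U ⁻¹' {π} := by
    ext ω; simp
  rw [h]
  refine (measure_biUnion_finset_le F _).trans (le_of_eq ?_)
  simp_rw [fun π => (hU π).2]
  rw [Finset.sum_const, nsmul_eq_mul, ENNReal.ofReal_div_of_pos (by positivity),
    ENNReal.ofReal_natCast, ENNReal.ofReal_natCast, div_eq_mul_inv]

/-- A random block rarely contains many more non-zeros than its share of them. -/
theorem IsUniformPerm.measure_lt_card_supp_blockGrad_le {J p sExact : ℕ} (hJ : 0 < J) (hp : 0 < p)
    {U : Ω → Equiv.Perm (Fin (J * p))} (hU : IsUniformPerm U μ) {f : Vec (J * p) → ℝ}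
    (hf : SparseGradients f sExact) (x : Vec (J * p)) (j : Fin J) :
    μ {ω | 1.1 * (sExact / J : ℝ) < (supp (blockGrad f (U ω) j x)).card} ≤
      ENNReal.ofReal (Real.exp (-(0.01 * sExact) / (3 * J))) := by
  have : Nonempty (Fin (J * p)) := ⟨⟨0, Nat.mul_pos hJ hp⟩⟩
  have hJ' : (0 : ℝ) < J := by exact_mod_cast hJ
  have hp' : (0 : ℝ) < p := by exact_mod_cast hp
  set S : Finset (Fin (J * p)) := Finset.univ.filter fun i => gradient f x i ≠ 0 with hS
  have hinj : Function.Injective fun l : Fin p => finProdFinEquiv (j, l) := fun a b h => by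
    simpa using h
  set B : Finset (Fin (J * p)) := Finset.univ.map ⟨fun l : Fin p => finProdFinEquiv (j, l), hinj⟩
    with hB
  have hcard : ∀ π : Equiv.Perm (Fin (J * p)),
      (supp (blockGrad f π j x)).card = (B.filter fun b => π b ∈ S).card := by
    intro π
    rw [hB, Finset.filter_map, Finset.card_map]
    congr 1
    ext l
    simp [mem_supp, blockGrad, hS, blockIndex]
  have hM : (B.card * S.card : ℝ) / Fintype.card (Fin (J * p)) ≤ sExact / J := by
    have hSc : (S.card : ℝ) ≤ sExact := Nat.cast_le.2 (hf x)
    rw [hB, Finset.card_map, Finset.card_univ, Fintype.card_fin, Fintype.card_fin, Nat.cast_mul,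
      mul_comm (J : ℝ), mul_div_mul_left _ _ hp'.ne']
    gcongr
  have h := card_perm_overfull_le S B hM
  have h2 := hU.measure_preimage_le (Finset.univ.filter fun π : Equiv.Perm (Fin (J * p)) =>
      1.1 * (sExact / J : ℝ) < ((B.filter fun b => π b ∈ S).card : ℝ))
  simp only [Finset.mem_filter, Finset.mem_univ, true_and] at h2
  simp_rw [hcard]
  refine h2.trans (ENNReal.ofReal_le_ofReal ?_)
  rw [Fintype.card_fin] at h
  rw [div_le_iff₀ (by positivity)]
  refine h.trans (le_of_eq ?_)
  rw [mul_comm]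
  congr 2
  field_simp

variable {m n : ℕ} {z : Ω → Matrix (Fin m) (Fin n) ℝ}

theorem IsRademacher.ae_exists_signMatrix [IsProbabilityMeasure μ] (hz : IsRademacher z μ) :
    ∀ᵐ ω ∂μ, ∃ ε, z ω = signMatrix ε := by
  have h : ∀ i l, ∀ᵐ ω ∂μ, z ω i l = 1 ∨ z ω i l = -1 := by
    intro i l
    have m1 : MeasurableSet {ω | z ω i l = 1} := hz.measurable i l (measurableSet_singleton 1)
    have m2 : MeasurableSet {ω | z ω i l = -1} :=
      hz.measurable i l (measurableSet_singleton (-1))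
    have hd : Disjoint {ω | z ω i l = 1} {ω | z ω i l = -1} := by
      rw [Set.disjoint_left]
      intro ω (h1 : z ω i l = 1) (h2 : z ω i l = -1)
      rw [h1] at h2
      norm_num at h2
    have hu : μ ({ω | z ω i l = 1} ∪ {ω | z ω i l = -1}) = 1 := by
      rw [measure_union hd m2, hz.prob_one, hz.prob_neg_one, ENNReal.add_halves]
    exact (prob_compl_eq_zero_iff (m1.union m2)).2 hu
  have h' : ∀ᵐ ω ∂μ, ∀ i l, z ω i l = 1 ∨ z ω i l = -1 :=
    ae_all_iff.2 fun i => ae_all_iff.2 fun l => h i l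
  filter_upwards [h'] with ω hω
  refine ⟨fun i l => decide (z ω i l = 1), ?_⟩
  ext i l
  by_cases h1 : z ω i l = 1
  · simp [signMatrix, boolSign, h1]
  · simp [signMatrix, boolSign, (hω i l).resolve_left h1]

theorem IsRademacher.measure_eq_signMatrix (hz : IsRademacher z μ) (ε : Fin m → Fin n → Bool) :
    μ {ω | z ω = signMatrix ε} = ENNReal.ofReal (((2 ^ n) ^ m : ℝ)⁻¹) := by
  have h := hz.indep.measure_inter_preimage_eq_mul Finset.univ
    (sets := fun q => {boolSign (ε q.1 q.2)}) (fun q _ => measurableSet_singleton _)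
  have e : {ω | z ω = signMatrix ε} =
      ⋂ q ∈ (Finset.univ : Finset (Fin m × Fin n)),
        (fun ω => z ω q.1 q.2) ⁻¹' {boolSign (ε q.1 q.2)} := by
    ext ω
    simp [← Matrix.ext_iff, signMatrix]
  have hq : ∀ q : Fin m × Fin n,
      μ ((fun ω => z ω q.1 q.2) ⁻¹' {boolSign (ε q.1 q.2)}) = 2⁻¹ := by
    intro q
    cases ε q.1 q.2
    · rw [← one_div]
      exact hz.prob_neg_one q.1 q.2
    · rw [← one_div]
      exact hz.prob_one q.1 q.2
  rw [e, h, Finset.prod_congr rfl fun q _ => hq q, Finset.prod_const, Finset.card_univ,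
    Fintype.card_prod, Fintype.card_fin, Fintype.card_fin, ENNReal.ofReal_inv_of_pos (by positivity),
    ← pow_mul, ENNReal.ofReal_pow (by norm_num), ENNReal.inv_pow, mul_comm m n]
  norm_num

/-- Random sign matrices have the restricted isometry property with high probability. -/
theorem IsRademacher.measure_not_restrictedIsometry_le [IsProbabilityMeasure μ]
    (hz : IsRademacher z μ) (hm : 0 < m) (k : ℕ) :
    μ {ω | ¬ RestrictedIsometry ((1 / Real.sqrt m) • z ω) k (1 / 10)} ≤
      ENNReal.ofReal (4 * (25 * n) ^ min k n * Real.exp (-m / 25000)) := by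
  classical
  set F := Finset.univ.filter fun ε : Fin m → Fin n → Bool =>
      ¬ RestrictedIsometry ((1 / Real.sqrt m) • signMatrix ε) k (1 / 10) with hF
  have hsub : {ω | ¬ RestrictedIsometry ((1 / Real.sqrt m) • z ω) k (1 / 10)} ≤ᵐ[μ]
      ⋃ ε ∈ F, {ω | z ω = signMatrix ε} := by
    filter_upwards [hz.ae_exists_signMatrix] with ω ⟨ε, hε⟩ hω
    refine Set.mem_iUnion₂.2 ⟨ε, Finset.mem_filter.2 ⟨Finset.mem_univ _, ?_⟩, hε⟩
    rw [← hε]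
    exact hω
  refine (measure_mono_ae hsub).trans ((measure_biUnion_finset_le F _).trans ?_)
  simp_rw [hz.measure_eq_signMatrix]
  rw [Finset.sum_const, ← ENNReal.ofReal_nsmul, nsmul_eq_mul]
  refine ENNReal.ofReal_le_ofReal ?_
  rw [← div_eq_mul_inv, div_le_iff₀ (by positivity), mul_comm]
  have := card_not_restrictedIsometry_le (n := n) hm k
  convert this using 2

end Probability

/-! ### The error bound and the number of queries -/

/-- The number of directions outweighs the union bound over the supports and the test vectors. -/
theorem union_bound_le {b₁ : ℝ} (hb : 625000 ≤ b₁) {J p s sExact : ℕ} (hp : 2 ≤ p)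
    (hs : 1.1 * (sExact : ℝ) / J ≤ s) :
    4 * (25 * p : ℝ) ^ min (4 * s) p * Real.exp (-(numDirections b₁ s p : ℝ) / 25000) ≤
      4 * Real.exp (-(0.01 * sExact) / (3 * J)) := by
  have hp' : (2 : ℝ) ≤ p := by exact_mod_cast hp
  have hlog2 : 0.5 ≤ Real.log p :=
    (by linarith [Real.log_two_gt_d9] : (0.5 : ℝ) ≤ Real.log 2).trans
      (Real.log_le_log (by norm_num) hp')
  have hs0 : (0 : ℝ) ≤ s := Nat.cast_nonneg s
  have hm : b₁ * s * Real.log p ≤ numDirections b₁ s p := Nat.le_ceil _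
  have hm2 : 625000 * (s * Real.log p) ≤ b₁ * s * Real.log p := by
    rw [mul_assoc]
    gcongr
  -- `25 ≤ 2 ^ 5`: at most `p ^ (24 s)` test vectors, against `p ^ (-25 s)` for each of them
  have h25 : (25 * p : ℝ) ≤ (p : ℝ) ^ 6 := by
    have : (2 : ℝ) ^ 5 ≤ (p : ℝ) ^ 5 := by gcongr
    nlinarith
  have hpow : (25 * p : ℝ) ^ min (4 * s) p ≤ Real.exp (24 * (s * Real.log p)) := by
    calc (25 * p : ℝ) ^ min (4 * s) p ≤ (25 * p : ℝ) ^ (4 * s) :=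
          pow_le_pow_right₀ (by linarith) (min_le_left _ _)
      _ ≤ ((p : ℝ) ^ 6) ^ (4 * s) := by gcongr
      _ = Real.exp (24 * (s * Real.log p)) := by
          rw [← pow_mul, ← Real.exp_log (show (0 : ℝ) < (p : ℝ) ^ (6 * (4 * s)) by positivity),
            Real.log_pow]
          push_cast
          congr 1
          ring
  have hJ : (0.01 * sExact : ℝ) / (3 * J) ≤ s * Real.log p := by
    have e : (0.01 * sExact : ℝ) / (3 * J) = 0.01 / 3.3 * (1.1 * (sExact : ℝ) / J) := by
      rw [mul_comm (3 : ℝ), ← div_div]; ring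
    have h0 : (0 : ℝ) ≤ 1.1 * (sExact : ℝ) / J := by positivity
    rw [e]
    nlinarith
  rw [mul_assoc]
  gcongr
  refine (mul_le_mul_of_nonneg_right hpow (Real.exp_pos _).le).trans ?_
  rw [← Real.exp_add]
  apply Real.exp_le_exp.2
  rw [neg_div, neg_div]
  linarith

/-- The query bound, up to the roundings of the sparsity level and of the number of directions. -/
theorem numQueries_block_le {b₁ : ℝ} (hb : 0 ≤ b₁) {J p : ℕ} (hJ : 0 < J) (s : ℕ) :
    (numQueries (numDirections b₁ ⌈1.1 * (s : ℝ) / J⌉₊ p) : ℝ) ≤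
      1.1 / J * numQueries (numDirections b₁ s p) + 2 * (b₁ * Real.log p + 1) := by
  have hlog : 0 ≤ Real.log (p : ℝ) := Real.log_natCast_nonneg p
  have hq : ∀ m : ℕ, (numQueries m : ℝ) = 2 * m := by
    intro m
    simp [numQueries, QueryLabel, mul_comm]
  have hceil : ((⌈1.1 * (s : ℝ) / J⌉₊ : ℕ) : ℝ) ≤ 1.1 * (s : ℝ) / J + 1 :=
    (Nat.ceil_lt_add_one (by positivity)).le
  have h1 : (numDirections b₁ ⌈1.1 * (s : ℝ) / J⌉₊ p : ℝ) ≤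
      b₁ * (1.1 * (s : ℝ) / J + 1) * Real.log p + 1 := by
    refine (Nat.ceil_lt_add_one (by positivity)).le.trans ?_
    gcongr
  have h2 : b₁ * s * Real.log p ≤ numDirections b₁ s p := Nat.le_ceil _
  have h3 : 1.1 / J * (b₁ * s * Real.log p) ≤ 1.1 / J * (numDirections b₁ s p : ℝ) := by gcongr
  have h4 : b₁ * (1.1 * (s : ℝ) / J + 1) * Real.log p =
      1.1 / J * (b₁ * s * Real.log p) + b₁ * Real.log p := by ring
  rw [hq, hq]
  linarith

/-- Outside a small exceptional set, every block of the gradient is `s`-sparse, every sampling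
matrix has the restricted isometry property and the noise obeys its bound, and then CoSaMP succeeds
for all blocks at once. The restricted isometry property serves all sparse vectors simultaneously,
so no independence between the blocks, the directions and the noise is needed. -/
theorem exists_event_norm_estimate_sub_le {b₁ : ℝ} (hb : 625000 ≤ b₁) {J p sExact : ℕ}
    (hJ : 0 < J) (hs0 : 0 < sExact) (hp : 2 ≤ p) {s N : ℕ} (hs : 1.1 * (sExact : ℝ) / J ≤ s)
    {f : Vec (J * p) → ℝ} {X : Set (Vec (J * p))} {H σ δ : ℝ} (hf : Differentiable ℝ f)
    (hsparse : SparseGradients f sExact) (hX : WeaklySparseHessian f X H) (hH : 0 < H)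
    (hσ : 0 < σ) (hδ : δ = 2 * Real.sqrt (σ / H)) {x : Vec (J * p)}
    (hseg : ∀ (π : Equiv.Perm (Fin (J * p))) (j : Fin J) (t : Vec p),
      (∀ l, |t l| = δ) → segment ℝ x (x + blockEmbed π j t) ⊆ X)
    {Ω : Type*} [MeasurableSpace Ω] {μ : Measure Ω} [IsProbabilityMeasure μ]
    {U : Ω → Equiv.Perm (Fin (J * p))}
    {z : Fin J → Ω → Matrix (Fin (numDirections b₁ s p)) (Fin p) ℝ}
    {ξ : Fin J → Ω → QueryLabel (numDirections b₁ s p) → ℝ} {ghat : Fin J → Ω → Vec p}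
    (hU : IsUniformPerm U μ) (hz : ∀ j, IsRademacher (z j) μ)
    (hξ : ∀ j q, ∀ᵐ ω ∂μ, |ξ j ω q| ≤ σ)
    (hest : ∀ j ω, IsGradientEstimate f (U ω) j x s δ N (z j ω) (ξ j ω) (ghat j ω)) :
    ∃ A : Set Ω, MeasurableSet A ∧
      1 - 5 * (J * Real.exp (-(0.01 * sExact) / (3 * J))) ≤ μ.real A ∧
      ∀ ω ∈ A, ∀ j, ‖ghat j ω - blockGrad f (U ω) j x‖ ≤
        (1 / 2) ^ N * ‖blockGrad f (U ω) j x‖ + 2 * 16 * Real.sqrt (σ * H) := by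
  have hJ' : (0 : ℝ) < J := by exact_mod_cast hJ
  have hs0' : (0 : ℝ) < sExact := by exact_mod_cast hs0
  have hspos : (0 : ℝ) < s := lt_of_lt_of_le (by positivity) hs
  have hlog : 0 < Real.log p := Real.log_pos (by exact_mod_cast hp)
  have hm : 0 < numDirections b₁ s p := Nat.ceil_pos.2 (by positivity)
  set E : ℝ := Real.exp (-(0.01 * sExact) / (3 * J)) with hE
  have hE0 : 0 < E := Real.exp_pos _
  set dense : Fin J → Set Ω := fun j =>
    {ω | 1.1 * (sExact / J : ℝ) < (supp (blockGrad f (U ω) j x)).card} with hdense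
  set noRIP : Fin J → Set Ω := fun j =>
    {ω | ¬ RestrictedIsometry ((1 / Real.sqrt (numDirections b₁ s p)) • z j ω) (4 * s) (1 / 10)}
    with hnoRIP
  set null : Set Ω := {ω | ¬ ∀ j, (∃ ε, z j ω = signMatrix ε) ∧ ∀ q, |ξ j ω q| ≤ σ} with hnull
  have hnull0 : μ null = 0 := by
    have : ∀ᵐ ω ∂μ, ∀ j, (∃ ε, z j ω = signMatrix ε) ∧ ∀ q, |ξ j ω q| ≤ σ :=
      ae_all_iff.2 fun j => ((hz j).ae_exists_signMatrix).and (ae_all_iff.2 fun q => hξ j q)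
    exact this
  have hdense_le : ∀ j, μ (dense j) ≤ ENNReal.ofReal E := fun j =>
    hU.measure_lt_card_supp_blockGrad_le hJ (by omega) hsparse x j
  have hnoRIP_le : ∀ j, μ (noRIP j) ≤ ENNReal.ofReal (4 * E) := fun j =>
    ((hz j).measure_not_restrictedIsometry_le hm (4 * s)).trans
      (ENNReal.ofReal_le_ofReal (union_bound_le hb hp hs))
  set bad : Set Ω := (⋃ j, dense j ∪ noRIP j) ∪ null with hbad
  have hbad_le : μ bad ≤ ENNReal.ofReal (5 * (J * E)) := by
    calc μ bad ≤ μ (⋃ j, dense j ∪ noRIP j) + μ null := measure_union_le _ _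
      _ ≤ (∑ j, μ (dense j ∪ noRIP j)) + 0 := by
          rw [hnull0]; gcongr; exact measure_iUnion_fintype_le _ _
      _ ≤ (∑ _j : Fin J, ENNReal.ofReal (E + 4 * E)) + 0 := by
          gcongr with j
          rw [ENNReal.ofReal_add hE0.le (by positivity)]
          exact (measure_union_le _ _).trans (add_le_add (hdense_le j) (hnoRIP_le j))
      _ = ENNReal.ofReal (5 * (J * E)) := by
          rw [add_zero, Finset.sum_const, Finset.card_univ, Fintype.card_fin,
            ← ENNReal.ofReal_nsmul, nsmul_eq_mul]
          congr 1
          ring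
  refine ⟨(toMeasurable μ bad)ᶜ, (measurableSet_toMeasurable _ _).compl, ?_, ?_⟩
  · rw [probReal_compl_eq_one_sub (measurableSet_toMeasurable _ _)]
    have : μ.real (toMeasurable μ bad) ≤ 5 * (J * E) := by
      rw [Measure.real, measure_toMeasurable]
      exact ENNReal.toReal_le_of_le_ofReal (by positivity) hbad_le
    linarith
  · intro ω hω j
    have hωbad : ω ∉ bad := fun h => hω (subset_toMeasurable μ bad h)
    have hωdense : ω ∉ dense j := fun h =>
      hωbad (Or.inl (Set.mem_iUnion.2 ⟨j, Or.inl h⟩))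
    have hωRIP : ω ∉ noRIP j := fun h =>
      hωbad (Or.inl (Set.mem_iUnion.2 ⟨j, Or.inr h⟩))
    have hωnull : ω ∉ null := fun h => hωbad (Or.inr h)
    simp only [hdense, Set.mem_ofPred_eq, not_lt] at hωdense
    simp only [hnoRIP, Set.mem_ofPred_eq, not_not] at hωRIP
    simp only [hnull, Set.mem_ofPred_eq, not_not] at hωnull
    obtain ⟨⟨ε, hε⟩, hnoise⟩ := hωnull j
    have hcard : (supp (blockGrad f (U ω) j x)).card ≤ s := by
      have : ((supp (blockGrad f (U ω) j x)).card : ℝ) ≤ s :=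
        hωdense.trans (by rwa [← mul_div_assoc])
      exact_mod_cast this
    have hsign : ∀ i l, |z j ω i l| = 1 := by
      intro i l
      rw [hε]
      simp only [signMatrix, Matrix.of_apply, boolSign]
      split_ifs <;> simp
    obtain ⟨e, he, hen⟩ := measurements_eq_add_error hf hX hH hσ hδ (U ω) j
      (fun t ht => hseg (U ω) j t ht) hsign hnoise
    have hout := hest j ω
    rw [IsGradientEstimate, he] at hout
    refine (hout.norm_sub_le hωRIP hcard).trans ?_
    linarith

end ZOBCD

theorem corollary2p3 :
    -- the constants are universal; `b₁` may be any sufficiently large number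
    ∃ b₀ ρ τ C : ℝ, 0 < b₀ ∧ 0 < ρ ∧ ρ < 1 ∧ 0 < τ ∧ 0 < C ∧
      ∀ b₁ : ℝ, b₀ ≤ b₁ →
      ∀ J p sExact : ℕ, 0 < J → 0 < sExact → sExact < J * p →
      -- the error bound
      (∀ s N : ℕ, 1.1 * (sExact : ℝ) / J ≤ s →
        ∀ (f : Vec (J * p) → ℝ) (X : Set (Vec (J * p))) (H σ δ : ℝ),
          BlockLipschitz f X → SparseGradients f sExact → WeaklySparseHessian f X H →
          0 < H → 0 < σ → δ = 2 * Real.sqrt (σ / H) →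
        -- the point `x` is fixed, and `X` contains the segments from `x` to the query points
        ∀ x : Vec (J * p),
          (∀ (π : Equiv.Perm (Fin (J * p))) (j : Fin J) (t : Vec p),
            (∀ l, |t l| = δ) → segment ℝ x (x + blockEmbed π j t) ⊆ X) →
        ∀ (Ω : Type*) [MeasurableSpace Ω] (μ : Measure Ω) [IsProbabilityMeasure μ]
          -- random blocks, and random directions for each block; `z j` and `z j'` may coincide
          (U : Ω → Equiv.Perm (Fin (J * p)))
          (z : Fin J → Ω → Matrix (Fin (numDirections b₁ s p)) (Fin p) ℝ)
          -- adversarial noise, which may depend on everything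
          (ξ : Fin J → Ω → QueryLabel (numDirections b₁ s p) → ℝ)
          (ghat : Fin J → Ω → Vec p),
          IsUniformPerm U μ → (∀ j, IsRademacher (z j) μ) →
          (∀ j q, ∀ᵐ ω ∂μ, |ξ j ω q| ≤ σ) →
          (∀ j ω, IsGradientEstimate f (U ω) j x s δ N (z j ω) (ξ j ω) (ghat j ω)) →
          ∃ A : Set Ω, MeasurableSet A ∧
            1 - C * (J * Real.exp (-(0.01 * sExact) / (3 * J))) ≤ μ.real A ∧
            ∀ ω ∈ A, ∀ j,
              ‖ghat j ω - blockGrad f (U ω) j x‖ ≤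
                ρ ^ N * ‖blockGrad f (U ω) j x‖ + 2 * τ * Real.sqrt (σ * H)) ∧
      -- the number of queries, compared with that for a sparsity level `s` with `sExact ≤ s`
      (∀ s : ℕ, sExact ≤ s →
        (numQueries (numDirections b₁ ⌈1.1 * (s : ℝ) / J⌉₊ p) : ℝ) ≤
          1.1 / J * numQueries (numDirections b₁ s p) + 2 * (b₁ * Real.log p + 1)) := by
  refine ⟨625000, 1 / 2, 16, 5, by norm_num, by norm_num, by norm_num, by norm_num, by norm_num, ?_⟩
  intro b₁ hb J p sExact hJ hs0 hsd
  refine ⟨?_, fun s _ => numQueries_block_le (by linarith) hJ s⟩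
  intro s N hs f X H σ δ hL hsparse hX hH hσ hδ x hseg Ω _ μ _ U z ξ ghat hU hz hξ hest
  have hf : Differentiable ℝ f := hL.1.differentiable one_ne_zero
  by_cases hp : 2 ≤ p
  · exact exists_event_norm_estimate_sub_le hb hJ hs0 hp hs hf hsparse hX hH hσ hδ hseg hU hz hξ
      hest
  · -- For blocks of size one there are no measurements, but `sExact < J`, so that the claimed
    -- probability is not positive.
    refine ⟨∅, MeasurableSet.empty, ?_, fun ω hω => absurd hω (Set.notMem_empty ω)⟩
    have hsJ : sExact < J :=
      hsd.trans_le ((Nat.mul_le_mul_left J (show p ≤ 1 by omega)).trans (by simp))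
    have hJ' : (1 : ℝ) ≤ J := by exact_mod_cast hJ
    have hsJ' : (sExact : ℝ) ≤ J := by exact_mod_cast hsJ.le
    have hexp := Real.add_one_le_exp (-(0.01 * sExact : ℝ) / (3 * J))
    have hfrac : -(1 / 2 : ℝ) ≤ -(0.01 * sExact : ℝ) / (3 * J) := by
      rw [le_div_iff₀ (by positivity)]
      linarith
    rw [measureReal_empty]
    nlinarith
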